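/- Let $C=[-\tfrac12,\tfrac12]^3$ be the unit cube, divided into its eight octants. A \emph{three-dimensional Hilbert curve} is a continuous map $\tau:[0,1]\to\mathbb R^3$ for which there are an ordering $C_1,\dots,C_8$ of the octants and, for each $i$, a symmetry $\gamma_i$ of $C$ (one of the $48$ signed permutations of the coordinates) and a map $\chi_i(t)=t$ (forward) or $\chi_i(t)=1-t$ (reversed), such that for each $i$ we have $\tau\big([\tfrac{i-1}8,\tfrac i8]\big)=C_i$ and, for all $t\in[0,1]$, $$\tau\Big(\frac{i-1+t}{8}\Big)=\rho_i\big(\gamma_i(\tau(\chi_i(t)))\big),$$ where $\rho_i$ is the translation and scaling that maps $C$ to $C_i$. The curve is \emph{facet-gated} if each of its gates $\tau(0)$ and $\tau(1)$ lies in the relative interior of a two-dimensional facet of $C$. Two curves are considered the same if they differ only by a symmetry of $C$ and/or reversal $t\mapsto 1-t$. The \emph{$k$-th order approximating curve} $A_k$ is the polygonal curve that connects the centres of the $8^k$ subcubes (of side $2^{-k}$) of $C$ in the order in which $\tau$ fills them. The curve is \emph{well-folded} if, up to rotation, reflection and reversal, the moves between consecutive vertices of $A_1$ are $+e_1,+e_2,-e_1,+e_3,+e_1,-e_2,-e_1$.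 It is \emph{hyperorthogonal} if, for all $k\ge 1$, every edge of $A_k$ is axis-parallel and every two consecutive edges of $A_k$ are parallel to different axes. \textbf{Theorem.} There is exactly one facet-gated three-dimensional Hilbert curve, up to symmetries of the cube and reversal. It is the curve Ca00.gs, which is well-folded and hyperorthogonal, and which is given by $C_1=[-\tfrac12,0]^3$ and $$\{\bar3,\bar1,\bar2]\ \ 1\ \ \{\bar3,\bar2,\bar1]\ \ 2\ \ [\bar3,2,\bar1\}\ \ \bar1\ \ \{2,\bar3,1]\ \ 3\ \ [2,3,1\}\ \ 1\ \ \{3,2,\bar1]\ \ \bar2\ \ [3,\bar2,\bar1\}\ \ \bar1\ \ [\bar2,\bar1,3\}.$$ Here the $i$-th bracketed triple $(\pi_i[1],\pi_i[2],\pi_i[3])$ describes octant $C_i$: the symmetry $\gamma_i$ maps the basis vector $e_j$ to $\operatorname{sgn}(\pi_i[j])\,e_{|\pi_i[j]|}$, a bar denotes a minus sign, $[\cdots\}$ denotes a forward and $\{\cdots]$ a reversed octant; the number $\pm j$ between two triples denotes the move $\pm e_j/2$ from the centre of one octant to the centre of the next. \textbf{Corollary.} If $\tau$ is a facet-gated three-dimensional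 Hilbert curve, then each of its two gates lies at distance exactly $1/3$ from two adjacent edges of the facet of $C$ that contains it, and at a larger distance from the other two edges of that facet. -/

import Mathlib

namespace Hilbert3D

noncomputable section

/-- Three-dimensional Euclidean space; coordinate axes are indexed by `Fin 3`. -/
abbrev E3 : Type := EuclideanSpace ℝ (Fin 3)

/-- The cube of volume one, centred at the origin. -/
def cube : Set E3 := {x | ∀ j, |x j| ≤ 1 / 2}

/-! ### Symmetries of the cube -/

/-- A symmetry of the cube, given as a signed permutation `π`: the `j`-th basis vector is mapped
to `sign j` times the basis vector with index `perm j`. -/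
structure CubeSymm where
  perm : Equiv.Perm (Fin 3)
  sign : Fin 3 → ℤˣ

/-- The linear map of a signed permutation: the non-zero entry in column `j` of its matrix is
`sign j`, and it is in row `perm j`. -/
def CubeSymm.map (γ : CubeSymm) (x : E3) : E3 :=
  WithLp.toLp 2 fun i => ((γ.sign (γ.perm.symm i) : ℤ) : ℝ) * x (γ.perm.symm i)

/-! ### Octants and self-similar octant-wise traversals -/

/-- The centre of the octant of the cube on the side `v j` of the centre for each axis `j`. -/
def octantCentre (v : Fin 3 → ℤˣ) : E3 := WithLp.toLp 2 fun j => ((v j : ℤ) : ℝ) / 4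

/-- The translation and scaling that maps the cube to the octant `v`. -/
def toOctant (v : Fin 3 → ℤˣ) (x : E3) : E3 := octantCentre v + (1 / 2 : ℝ) • x

/-- The description of a self-similar octant-by-octant traversal of the cube: the order in which
the octants are visited (the base pattern), and for each octant a symmetry of the cube
together with a bit that tells whether the direction of the traversal is reversed. -/
structure Traversal where
  octant : Fin 8 → (Fin 3 → ℤˣ)
  bijective_octant : Function.Bijective octant
  symm : Fin 8 → CubeSymm
  reversed : Fin 8 → Bool

/-- The transformation of the whole cube to the `i`-th octant of the traversal. -/
def Traversal.toSub (T : Traversal) (i : Fin 8) (x : E3) : E3 :=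
  toOctant (T.octant i) ((T.symm i).map x)

/-- The affine parametrization `t ↦ (i + t) / 8` of the `i`-th of the eight consecutive segments
of equal length of the unit interval (`i = 0, …, 7`). -/
def segment (i : Fin 8) (t : unitInterval) : unitInterval :=
  ⟨((i : ℕ) + (t : ℝ)) / 8, by
    have hi : ((i : ℕ) : ℝ) ≤ 7 := by exact_mod_cast Nat.le_of_lt_succ i.isLt
    have h0 := t.2.1
    have h1 := t.2.2
    constructor
    · positivity
    · linarith⟩

/-- The curve `τ` is continuous, octant-based and self-similar, as described by `T`:
each of the eight octants is filled by the corresponding segment of the curve,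
and the curve within the octant is the image of the whole curve, possibly reversed. -/
structure Traversal.Traces (T : Traversal) (τ : unitInterval → E3) : Prop where
  continuous : Continuous τ
  octant_based : ∀ i, τ '' Set.range (segment i) = toOctant (T.octant i) '' cube
  self_similar : ∀ i t, τ (segment i t) =
    T.toSub i (τ (if T.reversed i then unitInterval.symm t else t))

/-- A three-dimensional Hilbert curve is a continuous, octant-based, self-similar traversal
of the cube. -/
def IsHilbertCurve (τ : unitInterval → E3) : Prop := ∃ T : Traversal, T.Traces τ

/-- Two curves that traverse the cube are equivalent if they are equal up to a symmetry of the
cube (a rotation and/or reflection) and/or reversal of the direction. (Translation and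
scaling play no role since the curves fill the same cube.) -/
def Equivalent (τ τ' : unitInterval → E3) : Prop :=
  ∃ γ : CubeSymm, (∀ t, τ t = γ.map (τ' t)) ∨ (∀ t, τ t = γ.map (τ' (unitInterval.symm t)))

/-! ### Faces of the cube and gates -/

/-- The face of the cube on which coordinate `j` is fixed at `s j / 2` for all `j` with
`s j ≠ 0`. All faces of the cube, including the cube itself, are of this form. -/
def face (s : Fin 3 → SignType) : Set E3 :=
  {x | x ∈ cube ∧ ∀ j, s j ≠ 0 → x j = (s j : ℝ) / 2}

/-- The dimension of a face. -/
def faceDim (s : Fin 3 → SignType) : ℕ := (Finset.univ.filter fun j => s j = 0).card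

/-- Among all faces of the cube, the lowest-dimensional face that contains `p` is a
two-dimensional facet. -/
def IsFacetGate (p : E3) : Prop :=
  ∃ s, p ∈ face s ∧ faceDim s = 2 ∧ ∀ s', p ∈ face s' → 2 ≤ faceDim s'

/-- Both the entrance gate `τ 0` and the exit gate `τ 1` are facet gates. -/
def IsFacetGated (τ : unitInterval → E3) : Prop := IsFacetGate (τ 0) ∧ IsFacetGate (τ 1)

/-- `e` is an edge of the facet `f` of the cube. -/
def IsEdgeOf (e f : Fin 3 → SignType) : Prop := faceDim e = 1 ∧ face e ⊆ face f

/-- The point `p` of the facet `f` lies at distance 1/3 from two adjacent edges of `f`, and at a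
larger distance from the other edges of `f`. -/
def ThirdFromTwoAdjacentEdges (p : E3) (f : Fin 3 → SignType) : Prop :=
  ∃ e₁ e₂, e₁ ≠ e₂ ∧ IsEdgeOf e₁ f ∧ IsEdgeOf e₂ f ∧ (face e₁ ∩ face e₂).Nonempty ∧
    Metric.infDist p (face e₁) = 1 / 3 ∧ Metric.infDist p (face e₂) = 1 / 3 ∧
    ∀ e, IsEdgeOf e f → e ≠ e₁ → e ≠ e₂ → 1 / 3 < Metric.infDist p (face e)

/-! ### Approximating curves, well-foldedness and hyperorthogonality -/

/-- The `i`-th vertex (`i = 0, …, 8 ^ k - 1`) of the `k`-th order approximating curve, that is, the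
centre of the `i`-th subcube in the traversal of the grid of `8 ^ k` subcubes. -/
def Traversal.vertex (T : Traversal) : ℕ → ℕ → E3
  | 0, _ => 0
  | k + 1, i =>
    let b : Fin 8 := Fin.ofNat 8 (i / 8 ^ k)
    let j : ℕ := i % 8 ^ k
    T.toSub b (T.vertex k (if T.reversed b then 8 ^ k - 1 - j else j))

/-- The `i`-th edge (`i = 0, …, 8 ^ k - 2`) of the `k`-th order approximating curve, as a vector. -/
def Traversal.edge (T : Traversal) (k i : ℕ) : E3 := T.vertex k (i + 1) - T.vertex k i

/-- The vertices, in order, of the `d`-dimensional well-folded curve `G(d)` along the vertices of a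
cube: `G(d + 1)` is the concatenation of `G(d)`, an edge in the direction of the last
coordinate axis, and the reverse of `G(d)`. -/
def wellFoldedOrder : (d : ℕ) → List (Fin d → ℤˣ)
  | 0 => [Fin.elim0]
  | d + 1 =>
    (wellFoldedOrder d).map (fun v => Fin.snoc (α := fun _ => ℤˣ) v (-1)) ++
      ((wellFoldedOrder d).reverse).map (fun v => Fin.snoc (α := fun _ => ℤˣ) v 1)

/-- The first-order approximating curve is `G(3)`, modulo rotation, reflection and/or reversal. -/
def Traversal.IsWellFolded (T : Traversal) : Prop :=
  ∃ γ : CubeSymm,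
    (List.range 8).map (fun i => γ.map (T.vertex 1 i)) = (wellFoldedOrder 3).map octantCentre ∨
    (List.range 8).map (fun i => γ.map (T.vertex 1 i)) =
      ((wellFoldedOrder 3).map octantCentre).reverse

/-- The vector `v` is parallel to the `j`-th coordinate axis. -/
def ParallelToAxis (v : E3) (j : Fin 3) : Prop := v ≠ 0 ∧ ∀ l, l ≠ j → v l = 0

/-- For all `k ≥ 1` and `n ∈ {0, 1}`, the unsigned orientations of each sequence of `2 ^ n`
consecutive edges of the `k`-th order approximating curve are those of exactly `n + 1`
different coordinate axes. -/
def Traversal.IsHyperorthogonal (T : Traversal) : Prop :=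
  ∀ k n i : ℕ, 1 ≤ k → n ≤ 1 → i + 2 ^ n < 8 ^ k →
    ∃ S : Finset (Fin 3), S.card = n + 1 ∧
      (∀ m < 2 ^ n, ∃ j ∈ S, ParallelToAxis (T.edge k (i + m)) j) ∧
      (∀ j ∈ S, ∃ m < 2 ^ n, ParallelToAxis (T.edge k (i + m)) j)

/-! ### The curve Ca00.gs -/

/-- The permutation of three indices with the given list `f` of values, and inverse `g`. -/
def perm (f g : Fin 3 → Fin 3) (h : ∀ i, g (f i) = i) (h' : ∀ i, f (g i) = i) :
    Equiv.Perm (Fin 3) := ⟨f, g, h, h'⟩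

/-- The traversal Ca00.gs. In the notation by signed permutations of the axes 1, 2, 3, with `[…}` for
forward and `{…]` for reversed octants, and the moves between octants written in between,
this is
`{-3,-1,-2] 1 {-3,-2,-1] 2 [-3,2,-1} -1 {2,-3,1] 3 [2,3,1} 1 {3,2,-1] -2 [3,-2,-1} -1 [-2,-1,3}`
(axes 1, 2, 3 are the indices 0, 1, 2 below). -/
def ca00gs : Traversal where
  octant := ![![-1, -1, -1], ![1, -1, -1], ![1, 1, -1], ![-1, 1, -1],
    ![-1, 1, 1], ![1, 1, 1], ![1, -1, 1], ![-1, -1, 1]]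
  bijective_octant := by decide
  symm := ![
    ⟨perm ![2, 0, 1] ![1, 2, 0] (by decide) (by decide), ![-1, -1, -1]⟩,
    ⟨perm ![2, 1, 0] ![2, 1, 0] (by decide) (by decide), ![-1, -1, -1]⟩,
    ⟨perm ![2, 1, 0] ![2, 1, 0] (by decide) (by decide), ![-1, 1, -1]⟩,
    ⟨perm ![1, 2, 0] ![2, 0, 1] (by decide) (by decide), ![1, -1, 1]⟩,
    ⟨perm ![1, 2, 0] ![2, 0, 1] (by decide) (by decide), ![1, 1, 1]⟩,
    ⟨perm ![2, 1, 0] ![2, 1, 0] (by decide) (by decide), ![1, 1, -1]⟩,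
    ⟨perm ![2, 1, 0] ![2, 1, 0] (by decide) (by decide), ![1, -1, -1]⟩,
    ⟨perm ![1, 0, 2] ![1, 0, 2] (by decide) (by decide), ![-1, -1, 1]⟩]
  reversed := ![true, true, false, true, false, true, false, false]

end

end Hilbert3D

namespace Hilbert3D

/-! A gate of a facet-gated curve has exactly one coordinate of absolute value 1/2. The entrance
gate is also the image, inside the first octant, of one of the two gates. Comparing facets, the
symmetry of that octant must respect the gate axes, and no coordinate of the gate is zero: its signs
are those of the octant (`gate_of_gate`). The exit gate behaves in the same way in the last octant.
Magnifying the octant and repeating the argument gives the signs of the gate relative to that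
octant, a second binary digit of its position. Where two consecutive octants meet, the common point
is the image of a gate in both. Hence the octants share a facet, both symmetries send gate axes to
the axis of the move, and the first and second signs agree on the other axes
(`Traversal.Traces.joint`).

After a symmetry of the cube the first three octants are fixed, three Hamiltonian paths remain, and
the conditions on axes and signs form a finite search (`codes_of_octantPath`). It leaves Ca00.gs,
its reflected reversal, and two families in which the gate equation puts a gate on two facets at
once. Since the pieces contract by 1/2, the combinatorial data determine the curve
(`Traversal.Traces.unique`), so every facet-gated curve is equivalent to Ca00.gs.

Existence is a fixed-point argument: replacing a curve by the concatenation of its eight images is a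
contraction on the curves with prescribed end points, provided the end points match
(`Traversal.exists_traces`). Hyperorthogonality is an induction on the order, strengthened by the
fact that the first and last edges are not orthogonal to the gate facets. The corollary is read off
from the gates of Ca00.gs, whose coordinates within their facets are ±1/6. -/

/-! ### Finite encoding and exhaustive search -/

/-- The matrix of a signed permutation by rows, together with a direction bit: the non-zero entry
of row `i` is `sgn i`, in column `src i`. -/
structure RowCode where
  src : Fin 3 → Fin 3
  sgn : Fin 3 → ℤˣ
  rev : Bool

namespace RowCode

theorem ext_iff' (c d : RowCode) :
    c = d ↔ c.rev = d.rev ∧ (∀ i, c.src i = d.src i) ∧ ∀ i, c.sgn i = d.sgn i := by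
  refine ⟨by rintro rfl; simp, fun ⟨h₁, h₂, h₃⟩ => ?_⟩
  cases c; cases d
  simp only [mk.injEq]
  exact ⟨funext h₂, funext h₃, h₁⟩

instance : DecidableEq RowCode := fun c d => decidable_of_iff' _ (ext_iff' c d)

/-- The action of a signed permutation on sign vectors. -/
def act (c : RowCode) (s : Fin 3 → ℤˣ) (i : Fin 3) : ℤˣ := c.sgn i * s (c.src i)

end RowCode

/-- All sign vectors. -/
def signVector : Fin 8 → Fin 3 → ℤˣ :=
  ![![1, 1, 1], ![1, 1, -1], ![1, -1, 1], ![1, -1, -1],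
   ![-1, 1, 1], ![-1, 1, -1], ![-1, -1, 1], ![-1, -1, -1]]

/-- All permutations of the three axes. -/
def axisPerm : Fin 6 → Fin 3 → Fin 3 :=
  ![![0, 1, 2], ![0, 2, 1], ![1, 0, 2], ![1, 2, 0], ![2, 0, 1], ![2, 1, 0]]

theorem exists_signVector (v : Fin 3 → ℤˣ) : ∃ k, v = signVector k := by
  revert v; decide +kernel

theorem exists_axisPerm (σ : Equiv.Perm (Fin 3)) : ∃ k, ⇑σ = axisPerm k := by
  revert σ; decide +kernel

/-- A property of all row codes follows from the enumeration of permutations, signs and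
directions; the axes are tested first. -/
def AllCodes (A : (Fin 3 → Fin 3) → Bool → Prop) (P : RowCode → Prop) : Prop :=
  ∀ k r, A (axisPerm k) r → ∀ l, P ⟨axisPerm k, signVector l, r⟩

instance (A : (Fin 3 → Fin 3) → Bool → Prop) (P : RowCode → Prop)
    [∀ f r, Decidable (A f r)] [DecidablePred P] : Decidable (AllCodes A P) := by delta AllCodes; infer_instance

/-- Two octants share a facet. -/
def Adjacent (o o' : Fin 3 → ℤˣ) : Prop := ∃ l, o l ≠ o' l ∧ ∀ m, m ≠ l → o m = o' m

instance (o o' : Fin 3 → ℤˣ) : Decidable (Adjacent o o') := by delta Adjacent; infer_instance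

/-- The traversal of an octant `o` enters from the octant `o'` through the common facet. -/
def EnterAxis (ax : Bool → Fin 3) (o' o : Fin 3 → ℤˣ) (f : Fin 3 → Fin 3) (r : Bool) : Prop :=
  ∀ m, o m ≠ o' m → f m = ax r

instance (ax : Bool → Fin 3) (o' o : Fin 3 → ℤˣ) (f : Fin 3 → Fin 3) (r : Bool) :
    Decidable (EnterAxis ax o' o f r) := by delta EnterAxis; infer_instance

/-- The sign vector of a point of octant `o` on the facet shared with `o'` points to `o'`. -/
def FacingSign (o o' x : Fin 3 → ℤˣ) : Prop := ∀ m, o m ≠ o' m → x m = o' m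

instance (o o' x : Fin 3 → ℤˣ) : Decidable (FacingSign o o' x) := by delta FacingSign; infer_instance

/-- The sign vectors of a point relative to the adjacent octants `o` and `o'` agree, except on the
axis that separates the octants. -/
def AgreeOff (o o' x x' : Fin 3 → ℤˣ) : Prop := ∀ m, o m = o' m → x m = x' m

instance (o o' x x' : Fin 3 → ℤˣ) : Decidable (AgreeOff o o' x x') := by delta AgreeOff; infer_instance

/-- The conditions on the signed permutations of the consecutive octants `o` and `o'`, with gate
facets `ax` and sign vectors of the gates `s` (first level) and `t` (second level). -/
structure Joint (ax : Bool → Fin 3) (s t : Bool → Fin 3 → ℤˣ) (o o' : Fin 3 → ℤˣ)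
    (c c' : RowCode) : Prop where
  exitAxis : EnterAxis ax o' o c.src (!c.rev)
  enterAxis : EnterAxis ax o o' c'.src c'.rev
  exitSign : FacingSign o o' (c.act (s (!c.rev)))
  enterSign : FacingSign o' o (c'.act (s c'.rev))
  agree₁ : AgreeOff o o' (c.act (s (!c.rev))) (c'.act (s c'.rev))
  agree₂ : AgreeOff o o' (c.act (t (!c.rev))) (c'.act (t c'.rev))

/-- The three Hamiltonian paths along the octants that start with `(-,-,-)`, `(+,-,-)`,
`(+,+,-)`. -/
def octantPath : Fin 3 → Fin 8 → Fin 3 → ℤˣ :=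
  ![![![-1, -1, -1], ![1, -1, -1], ![1, 1, -1], ![-1, 1, -1], ![-1, 1, 1], ![1, 1, 1], ![1, -1, 1], ![-1, -1, 1]],
   ![![-1, -1, -1], ![1, -1, -1], ![1, 1, -1], ![-1, 1, -1], ![-1, 1, 1], ![-1, -1, 1], ![1, -1, 1], ![1, 1, 1]],
   ![![-1, -1, -1], ![1, -1, -1], ![1, 1, -1], ![1, 1, 1], ![1, -1, 1], ![-1, -1, 1], ![-1, 1, 1], ![-1, 1, -1]]]

set_option synthInstance.maxHeartbeats 400000 in
set_option synthInstance.maxSize 4096 in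
-- Adjacency already separates successive octants, so each new octant is only compared with those
-- visited at least two steps earlier. Interleaving tests and quantifiers keeps the decision tree
-- small.
theorem exists_octantPath_aux :
    ∀ a : Fin 3 → ℤˣ, Adjacent ![1, 1, -1] a → a ∉ [![-1, -1, -1], ![1, -1, -1]] →
    ∀ b : Fin 3 → ℤˣ, Adjacent a b → b ∉ [![-1, -1, -1], ![1, -1, -1], ![1, 1, -1]] →
    ∀ c : Fin 3 → ℤˣ, Adjacent b c → c ∉ [![-1, -1, -1], ![1, -1, -1], ![1, 1, -1], a] →
    ∀ d : Fin 3 → ℤˣ, Adjacent c d → d ∉ [![-1, -1, -1], ![1, -1, -1], ![1, 1, -1], a, b] →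
    ∀ e : Fin 3 → ℤˣ, Adjacent d e → e ∉ [![-1, -1, -1], ![1, -1, -1], ![1, 1, -1], a, b, c] →
    ∃ k, ![![-1, -1, -1], ![1, -1, -1], ![1, 1, -1], a, b, c, d, e] = octantPath k := by
  decide +kernel

/-- The conditions of `Joint` on the octant `o'` that involve only axes. -/
def AxesOK (ax : Bool → Fin 3) (o o' o'' : Fin 3 → ℤˣ) (f : Fin 3 → Fin 3) (r : Bool) : Prop :=
  EnterAxis ax o o' f r ∧ EnterAxis ax o'' o' f (!r)

instance (ax : Bool → Fin 3) (o o' o'' : Fin 3 → ℤˣ) (f : Fin 3 → Fin 3) (r : Bool) :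
    Decidable (AxesOK ax o o' o'' f r) := by delta AxesOK; infer_instance

/-- The conditions of `Joint` that involve signs. -/
def SignsOK (s t : Bool → Fin 3 → ℤˣ) (o o' : Fin 3 → ℤˣ) (c c' : RowCode) : Prop :=
  FacingSign o' o (c'.act (s c'.rev)) ∧ AgreeOff o o' (c.act (s (!c.rev))) (c'.act (s c'.rev)) ∧
    AgreeOff o o' (c.act (t (!c.rev))) (c'.act (t c'.rev))

instance (s t : Bool → Fin 3 → ℤˣ) (o o' : Fin 3 → ℤˣ) (c c' : RowCode) :
    Decidable (SignsOK s t o o' c c') := by delta SignsOK; infer_instance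

/-- The row code of the symmetry and direction of an octant. -/
def Traversal.code (T : Traversal) (i : Fin 8) : RowCode :=
  ⟨fun m => (T.symm i).perm.symm m, fun m => (T.symm i).sign ((T.symm i).perm.symm m),
    T.reversed i⟩

/-- A first octant whose symmetry forces the entrance gate onto an edge of the cube. -/
def edgeFirst : RowCode := ⟨![2, 1, 0], ![1, 1, 1], false⟩

/-- A last octant whose symmetry forces the exit gate onto an edge of the cube. -/
def edgeLast : RowCode := ⟨![2, 1, 0], ![-1, 1, -1], false⟩

/-- The row codes of the reversal of Ca00.gs, reflected in the last axis. -/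
def revCode (i : Fin 8) : RowCode :=
  ⟨(ca00gs.code i.rev).src,
    fun m => ![1, 1, -1] m * (ca00gs.code i.rev).sgn m * ![1, 1, -1] ((ca00gs.code i.rev).src m),
    (ca00gs.code i.rev).rev⟩

/-- The pair of values `x` at `false` and `y` at `true`. -/
def pair {α : Type*} (x y : α) (b : Bool) : α := cond b y x

set_option synthInstance.maxHeartbeats 400000 in
set_option synthInstance.maxSize 4096 in
-- The two end octants come first because they alone determine the second-level signs `t`; the
-- others follow along the path, with axes tested before signs. The alternatives `edgeFirst` and
-- `edgeLast` are left open here and are excluded afterwards by solving for the gate exactly.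
theorem codes_of_octantPath :
    ∀ (k : Fin 3) (a₀ a₁ : Fin 3),
    let o := octantPath k
    let ax := pair a₀ a₁
    let s := pair (o 0) (o 7)
    AllCodes (fun f r => f (ax false) = ax r ∧ EnterAxis ax (o 1) (o 0) f (!r)) fun c₀ =>
    c₀.act (s c₀.rev) (ax false) = o 0 (ax false) →
    FacingSign (o 0) (o 1) (c₀.act (s (!c₀.rev))) →
    AllCodes (fun f r => f (ax true) = ax (!r) ∧ EnterAxis ax (o 6) (o 7) f r) fun c₇ =>
    c₇.act (s (!c₇.rev)) (ax true) = o 7 (ax true) →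
    FacingSign (o 7) (o 6) (c₇.act (s c₇.rev)) →
    let t := pair (c₀.act (s c₀.rev)) (c₇.act (s (!c₇.rev)))
    AllCodes (AxesOK ax (o 0) (o 1) (o 2)) fun c₁ =>
    SignsOK s t (o 0) (o 1) c₀ c₁ → FacingSign (o 1) (o 2) (c₁.act (s (!c₁.rev))) →
    AllCodes (AxesOK ax (o 1) (o 2) (o 3)) fun c₂ =>
    SignsOK s t (o 1) (o 2) c₁ c₂ → FacingSign (o 2) (o 3) (c₂.act (s (!c₂.rev))) →
    AllCodes (AxesOK ax (o 2) (o 3) (o 4)) fun c₃ =>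
    SignsOK s t (o 2) (o 3) c₂ c₃ → FacingSign (o 3) (o 4) (c₃.act (s (!c₃.rev))) →
    AllCodes (AxesOK ax (o 3) (o 4) (o 5)) fun c₄ =>
    SignsOK s t (o 3) (o 4) c₃ c₄ → FacingSign (o 4) (o 5) (c₄.act (s (!c₄.rev))) →
    AllCodes (AxesOK ax (o 4) (o 5) (o 6)) fun c₅ =>
    SignsOK s t (o 4) (o 5) c₄ c₅ → FacingSign (o 5) (o 6) (c₅.act (s (!c₅.rev))) →
    AllCodes (AxesOK ax (o 5) (o 6) (o 7)) fun c₆ =>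
    SignsOK s t (o 5) (o 6) c₅ c₆ → FacingSign (o 6) (o 7) (c₆.act (s (!c₆.rev))) →
    SignsOK s t (o 6) (o 7) c₆ c₇ →
    k = 0 ∧ (c₀ = edgeFirst ∨ c₇ = edgeLast ∨
      (∀ i, ![c₀, c₁, c₂, c₃, c₄, c₅, c₆, c₇] i = ca00gs.code i) ∨
      ∀ i, ![c₀, c₁, c₂, c₃, c₄, c₅, c₆, c₇] i = revCode i) := by
  decide +kernel

/-! ### Coordinates -/

theorem CubeSymm.map_apply (γ : CubeSymm) (x : E3) (i : Fin 3) :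
    γ.map x i = ((γ.sign (γ.perm.symm i) : ℤ) : ℝ) * x (γ.perm.symm i) := rfl

theorem octantCentre_apply (v : Fin 3 → ℤˣ) (i : Fin 3) :
    octantCentre v i = ((v i : ℤ) : ℝ) / 4 := rfl

theorem toOctant_apply (v : Fin 3 → ℤˣ) (x : E3) (i : Fin 3) :
    toOctant v x i = ((v i : ℤ) : ℝ) / 4 + 1 / 2 * x i := by
  simp [toOctant, octantCentre_apply]

theorem Traversal.toSub_apply (T : Traversal) (i : Fin 8) (x : E3) (m : Fin 3) :
    T.toSub i x m = ((T.octant i m : ℤ) : ℝ) / 4 + 1 / 2 * (T.symm i).map x m :=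
  toOctant_apply _ _ _

theorem cast_unit (u : ℤˣ) : ((u : ℤ) : ℝ) = 1 ∨ ((u : ℤ) : ℝ) = -1 := by
  rcases Int.units_eq_one_or u with h | h <;> simp [h]

theorem abs_unit_mul (u : ℤˣ) (x : ℝ) : |((u : ℤ) : ℝ) * x| = |x| := by
  rcases cast_unit u with h | h <;> simp [h]

theorem CubeSymm.abs_map_apply (γ : CubeSymm) (x : E3) (i : Fin 3) :
    |γ.map x i| = |x (γ.perm.symm i)| := by
  rw [γ.map_apply, abs_unit_mul]

/-! ### Facet gates -/

/-- The point `x` lies in the relative interior of a facet orthogonal to axis `j`. -/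
def IsGateOn (x : E3) (j : Fin 3) : Prop := |x j| = 1 / 2 ∧ ∀ l, l ≠ j → |x l| < 1 / 2

theorem IsGateOn.abs_le {x : E3} {j : Fin 3} (h : IsGateOn x j) (l : Fin 3) : |x l| ≤ 1 / 2 := by
  by_cases hl : l = j
  · rw [hl, h.1]
  · exact (h.2 l hl).le

theorem IsGateOn.eq_of_abs {x : E3} {j l : Fin 3} (h : IsGateOn x j) (hl : |x l| = 1 / 2) :
    l = j := by
  by_contra hne
  exact (h.2 l hne).ne hl

theorem IsGateOn.map {x : E3} {j : Fin 3} (h : IsGateOn x j) (γ : CubeSymm) :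
    IsGateOn (γ.map x) (γ.perm j) := by
  refine ⟨by rw [γ.abs_map_apply, Equiv.symm_apply_apply, h.1], fun l hl => ?_⟩
  rw [γ.abs_map_apply]
  exact h.2 _ fun h' => hl (by rw [← h', Equiv.apply_symm_apply])

theorem abs_cast_sign {s : SignType} (hs : s ≠ 0) : |(s : ℝ)| = 1 := by
  cases s <;> simp_all

theorem abs_eq_half_of_mem_face {p : E3} {s : Fin 3 → SignType} (hp : p ∈ face s) {j : Fin 3}
    (hj : s j ≠ 0) : |p j| = 1 / 2 := by
  rw [hp.2 j hj, abs_div, abs_cast_sign hj]; norm_num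

theorem exists_sign_eq {x : ℝ} (hx : |x| = 1 / 2) : ∃ s : SignType, s ≠ 0 ∧ x = (s : ℝ) / 2 := by
  rcases (abs_eq (by norm_num)).1 hx with h | h
  · exact ⟨1, by decide, by simp [h]⟩
  · exact ⟨-1, by decide, by simp [h]; norm_num⟩

/-- The smallest face containing a point of the cube has one free axis for each coordinate of
absolute value less than 1/2. -/
theorem isFacetGate_iff (p : E3) : IsFacetGate p ↔ ∃ j, IsGateOn p j := by
  constructor
  · rintro ⟨s, hs, hdim, hmin⟩
    obtain ⟨j, hj⟩ : ∃ j, s j ≠ 0 := by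
      by_contra! h
      simp [faceDim, h] at hdim
    refine ⟨j, abs_eq_half_of_mem_face hs hj, fun l hl => lt_of_le_of_ne (hs.1 l) fun h => ?_⟩
    obtain ⟨u, hu, hpu⟩ := exists_sign_eq h
    -- A second coordinate of absolute value 1/2 would put `p` on a face with two fixed axes, of
    -- dimension at most 1.
    have hmem : p ∈ face (Function.update s l u) := by
      refine ⟨hs.1, fun m hm => ?_⟩
      by_cases hml : m = l
      · subst hml; simpa using hpu
      · rw [Function.update_of_ne hml] at hm ⊢
        exact hs.2 m hm
    have hle := hmin _ hmem
    have hsub : (Finset.univ.filter fun m => Function.update s l u m = 0) ⊆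
        Finset.univ \ {j, l} := by
      intro m hm
      simp only [Finset.mem_filter, Finset.mem_univ, true_and] at hm
      simp only [Finset.mem_sdiff, Finset.mem_univ, true_and, Finset.mem_insert,
        Finset.mem_singleton, not_or]
      refine ⟨?_, ?_⟩
      · rintro rfl
        rw [Function.update_of_ne hl.symm] at hm
        exact hj hm
      · rintro rfl
        rw [Function.update_self] at hm
        exact hu hm
    have hc := Finset.card_le_card hsub
    have h2 : (Finset.univ \ {j, l} : Finset (Fin 3)).card = 1 := by
      rw [Finset.card_sdiff_of_subset (Finset.subset_univ _), Finset.card_pair hl.symm]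
      rfl
    have := hle.trans hc
    omega
  · rintro ⟨j, hj⟩
    obtain ⟨u, hu, hpu⟩ := exists_sign_eq hj.1
    refine ⟨Function.update 0 j u, ⟨hj.abs_le, fun m hm => ?_⟩, ?_, fun s' hs' => ?_⟩
    · by_cases hml : m = j
      · subst hml; simpa using hpu
      · rw [Function.update_of_ne hml] at hm
        exact absurd rfl hm
    · have : (Finset.univ.filter fun m => Function.update (0 : Fin 3 → SignType) j u m = 0) =
          Finset.univ.erase j := by
        ext m
        by_cases hml : m = j
        · subst hml; simp [hu]
        · simp [hml]
      rw [faceDim, this, Finset.card_erase_of_mem (Finset.mem_univ _)]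
      rfl
    · have hsub : Finset.univ.erase j ⊆ Finset.univ.filter fun m => s' m = 0 := by
        intro m hm
        simp only [Finset.mem_filter, Finset.mem_univ, true_and]
        by_contra hne
        exact (Finset.mem_erase.1 hm).1 (hj.eq_of_abs (abs_eq_half_of_mem_face hs' hne))
      have := Finset.card_le_card hsub
      rwa [Finset.card_erase_of_mem (Finset.mem_univ _)] at this

/-! ### Signs of points -/

/-- The coordinates of `x` are non-zero and have the signs `s`. -/
def HasSigns (x : E3) (s : Fin 3 → ℤˣ) : Prop := ∀ j, 0 < ((s j : ℤ) : ℝ) * x j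

theorem unit_eq_of_mul_pos {u v : ℤˣ} {x : ℝ} (hu : 0 < ((u : ℤ) : ℝ) * x)
    (hv : 0 < ((v : ℤ) : ℝ) * x) : u = v := by
  rcases Int.units_eq_one_or u with rfl | rfl <;> rcases Int.units_eq_one_or v with rfl | rfl <;>
    first | rfl | (exfalso; push_cast at hu hv; linarith)

theorem Traversal.hasSigns_map (T : Traversal) (i : Fin 8) {x : E3} {s : Fin 3 → ℤˣ}
    (h : HasSigns x s) : HasSigns ((T.symm i).map x) ((T.code i).act s) := by
  intro j
  have hj := h ((T.symm i).perm.symm j)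
  rw [CubeSymm.map_apply]
  simp only [RowCode.act, Traversal.code, Units.val_mul, Int.cast_mul]
  rcases cast_unit ((T.symm i).sign ((T.symm i).perm.symm j)) with h' | h' <;> rw [h'] <;> linarith

theorem unit_ne {u v : ℤˣ} (h : u ≠ v) : ((v : ℤ) : ℝ) = -((u : ℤ) : ℝ) := by
  rcases Int.units_eq_one_or u with rfl | rfl <;> rcases Int.units_eq_one_or v with rfl | rfl <;>
    simp_all

/-- A facet gate that is the image of a facet gate in the octant `v`. -/
theorem gate_of_gate {x y : E3} {a b : Fin 3} {v : Fin 3 → ℤˣ} {γ : CubeSymm}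
    (hx : IsGateOn x a) (hy : IsGateOn y b) (h : x = toOctant v (γ.map y)) :
    γ.perm.symm a = b ∧ HasSigns x v ∧ 0 < ((v a : ℤ) : ℝ) * γ.map y a := by
  have hc : ∀ m, x m = ((v m : ℤ) : ℝ) / 4 + 1 / 2 * γ.map y m := fun m => by
    rw [h, toOctant_apply]
  have hle : ∀ m, |γ.map y m| ≤ 1 / 2 := fun m => by
    rw [γ.abs_map_apply]; exact hy.abs_le _
  -- An octant centre is at 1/4 from the middle and the scaled point adds at most 1/4, so reaching
  -- 1/2 forces the extreme value on the side of `v a`.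
  have hxa : γ.map y a = ((v a : ℤ) : ℝ) / 2 := by
    have h1 := hx.1
    rw [hc a] at h1
    have h2 := abs_le.1 (hle a)
    rcases cast_unit (v a) with h' | h' <;> rw [h'] at h1 ⊢ <;>
      rcases (abs_eq (by norm_num)).1 h1 with h3 | h3 <;> linarith
  have hab : γ.perm.symm a = b := by
    apply hy.eq_of_abs
    rw [← γ.abs_map_apply, hxa]
    rcases cast_unit (v a) with h' | h' <;> rw [h'] <;> norm_num
  have hpos : 0 < ((v a : ℤ) : ℝ) * γ.map y a := by
    rw [hxa]
    rcases cast_unit (v a) with h' | h' <;> rw [h'] <;> norm_num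
  refine ⟨hab, fun m => ?_, hpos⟩
  by_cases hm : m = a
  · subst hm
    rw [hc m]
    rcases cast_unit (v m) with h' | h' <;> rw [h'] at hpos ⊢ <;> linarith
  -- Off the gate axis the scaled offset is strictly below 1/4, so it cannot cancel the coordinate
  -- of the octant centre.
  · have hlt : |γ.map y m| < 1 / 2 := by
      rw [γ.abs_map_apply]
      exact hy.2 _ fun h' => hm (γ.perm.symm.injective (h'.trans hab.symm))
    rw [abs_lt] at hlt
    rw [hc m]
    rcases cast_unit (v m) with h' | h' <;> rw [h'] <;> linarith

/-- A common point of two octants that is the image of facet gates in both. -/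
theorem gates_of_common {y y' : E3} {b b' : Fin 3} {v v' : Fin 3 → ℤˣ} {γ γ' : CubeSymm}
    (hy : IsGateOn y b) (hy' : IsGateOn y' b')
    (h : toOctant v (γ.map y) = toOctant v' (γ'.map y')) (m : Fin 3) :
    (v m ≠ v' m → γ.perm.symm m = b ∧ γ'.perm.symm m = b' ∧
      0 < ((v' m : ℤ) : ℝ) * γ.map y m ∧ 0 < ((v m : ℤ) : ℝ) * γ'.map y' m) ∧
    (v m = v' m → γ.map y m = γ'.map y' m) := by
  have hc : ((v m : ℤ) : ℝ) / 4 + 1 / 2 * γ.map y m =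
      ((v' m : ℤ) : ℝ) / 4 + 1 / 2 * γ'.map y' m := by
    rw [← toOctant_apply, h, toOctant_apply]
  refine ⟨fun hne => ?_, fun heq => by rw [heq] at hc; linarith⟩
  have hv := unit_ne hne
  have h1 : |γ.map y m| ≤ 1 / 2 := by rw [γ.abs_map_apply]; exact hy.abs_le _
  have h2 : |γ'.map y' m| ≤ 1 / 2 := by rw [γ'.abs_map_apply]; exact hy'.abs_le _
  have h1' := abs_le.1 h1
  have h2' := abs_le.1 h2
  -- On a separating axis the two local coordinates differ by 1, while each is at most 1/2 in
  -- absolute value: both are extreme and opposite.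
  have e1 : γ.map y m = ((v' m : ℤ) : ℝ) / 2 := by
    rw [hv] at hc ⊢
    rcases cast_unit (v m) with h' | h' <;> rw [h'] at hc ⊢ <;> linarith
  have e2 : γ'.map y' m = ((v m : ℤ) : ℝ) / 2 := by
    rw [hv] at hc e1
    linarith
  refine ⟨hy.eq_of_abs ?_, hy'.eq_of_abs ?_, ?_, ?_⟩
  · rw [← γ.abs_map_apply, e1]
    rcases cast_unit (v' m) with h' | h' <;> rw [h'] <;> norm_num
  · rw [← γ'.abs_map_apply, e2]
    rcases cast_unit (v m) with h' | h' <;> rw [h'] <;> norm_num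
  · rw [e1]
    rcases cast_unit (v' m) with h' | h' <;> rw [h'] <;> norm_num
  · rw [e2]
    rcases cast_unit (v m) with h' | h' <;> rw [h'] <;> norm_num

/-! ### The gates of a traversal -/

/-- The entrance gate (`false`) or the exit gate (`true`) of a curve. -/
def gate (τ : unitInterval → E3) (b : Bool) : E3 := τ (cond b 1 0)

theorem segment_zero_zero : segment 0 0 = 0 := by
  ext; simp [segment]

theorem segment_seven_one : segment 7 1 = 1 := by
  ext; simp [segment]; norm_num

theorem segment_castSucc_one (i : Fin 7) : segment i.castSucc 1 = segment i.succ 0 := by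
  ext; simp [segment]

variable {T : Traversal} {τ : unitInterval → E3}

theorem Traversal.Traces.segment_zero (h : T.Traces τ) (i : Fin 8) :
    τ (segment i 0) = T.toSub i (gate τ (T.reversed i)) := by
  rw [h.self_similar]
  cases T.reversed i <;> simp [gate]

theorem Traversal.Traces.segment_one (h : T.Traces τ) (i : Fin 8) :
    τ (segment i 1) = T.toSub i (gate τ (!T.reversed i)) := by
  rw [h.self_similar]
  cases T.reversed i <;> simp [gate]

theorem Traversal.Traces.gate_false (h : T.Traces τ) :
    gate τ false = T.toSub 0 (gate τ (T.reversed 0)) := by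
  rw [← h.segment_zero, segment_zero_zero]; rfl

theorem Traversal.Traces.gate_true (h : T.Traces τ) :
    gate τ true = T.toSub 7 (gate τ (!T.reversed 7)) := by
  rw [← h.segment_one, segment_seven_one]; rfl

theorem Traversal.Traces.gate_joint (h : T.Traces τ) (i : Fin 7) :
    T.toSub i.castSucc (gate τ (!T.reversed i.castSucc)) =
      T.toSub i.succ (gate τ (T.reversed i.succ)) := by
  rw [← h.segment_one, ← h.segment_zero, segment_castSucc_one]

/-- Every axis separating the octants is the image of the single gate axis of the first of them, so
there is only one. -/
theorem Traversal.Traces.adjacent (h : T.Traces τ) {ax : Bool → Fin 3}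
    (hax : ∀ b, IsGateOn (gate τ b) (ax b)) (i : Fin 7) :
    Adjacent (T.octant i.castSucc) (T.octant i.succ) := by
  have hne : T.octant i.castSucc ≠ T.octant i.succ := fun h' =>
    (Fin.castSucc_lt_succ (i := i)).ne (T.bijective_octant.injective h')
  obtain ⟨l, hl⟩ := Function.ne_iff.1 hne
  refine ⟨l, hl, fun m hm => ?_⟩
  by_contra hm'
  have key := gates_of_common (hax _) (hax _) (h.gate_joint i)
  exact hm ((T.symm i.castSucc).perm.symm.injective
    (((key m).1 hm').1.trans ((key l).1 hl).1.symm))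

/-- The signs of the gates. -/
def Traversal.gateSigns (T : Traversal) : Bool → Fin 3 → ℤˣ := pair (T.octant 0) (T.octant 7)

/-- The signs of the gates relative to the octants that contain them. -/
def Traversal.subSigns (T : Traversal) : Bool → Fin 3 → ℤˣ :=
  pair ((T.code 0).act (T.gateSigns (T.code 0).rev))
    ((T.code 7).act (T.gateSigns (!(T.code 7).rev)))

theorem Traversal.Traces.end_false (h : T.Traces τ) {ax : Bool → Fin 3}
    (hax : ∀ b, IsGateOn (gate τ b) (ax b)) :
    (T.code 0).src (ax false) = ax (T.code 0).rev ∧ HasSigns (gate τ false) (T.octant 0) ∧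
      0 < ((T.octant 0 (ax false) : ℤ) : ℝ) *
        (T.symm 0).map (gate τ (T.code 0).rev) (ax false) :=
  gate_of_gate (hax _) (hax _) h.gate_false

theorem Traversal.Traces.end_true (h : T.Traces τ) {ax : Bool → Fin 3}
    (hax : ∀ b, IsGateOn (gate τ b) (ax b)) :
    (T.code 7).src (ax true) = ax (!(T.code 7).rev) ∧ HasSigns (gate τ true) (T.octant 7) ∧
      0 < ((T.octant 7 (ax true) : ℤ) : ℝ) *
        (T.symm 7).map (gate τ (!(T.code 7).rev)) (ax true) :=
  gate_of_gate (hax _) (hax _) h.gate_true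

theorem Traversal.Traces.hasSigns_gate (h : T.Traces τ) {ax : Bool → Fin 3}
    (hax : ∀ b, IsGateOn (gate τ b) (ax b)) (b : Bool) :
    HasSigns (gate τ b) (T.gateSigns b) := by
  cases b
  · exact (h.end_false hax).2.1
  · exact (h.end_true hax).2.1

theorem Traversal.Traces.end_false_sign (h : T.Traces τ) {ax : Bool → Fin 3}
    (hax : ∀ b, IsGateOn (gate τ b) (ax b)) :
    (T.code 0).act (T.gateSigns (T.code 0).rev) (ax false) = T.octant 0 (ax false) :=
  unit_eq_of_mul_pos (T.hasSigns_map 0 (h.hasSigns_gate hax _) _) (h.end_false hax).2.2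

theorem Traversal.Traces.end_true_sign (h : T.Traces τ) {ax : Bool → Fin 3}
    (hax : ∀ b, IsGateOn (gate τ b) (ax b)) :
    (T.code 7).act (T.gateSigns (!(T.code 7).rev)) (ax true) = T.octant 7 (ax true) :=
  unit_eq_of_mul_pos (T.hasSigns_map 7 (h.hasSigns_gate hax _) _) (h.end_true hax).2.2

/-- The point `y` is the gate in the magnified coordinates of its own octant. It is a symmetric
image of a gate, so its signs are known as well. -/
theorem Traversal.Traces.exists_sub (h : T.Traces τ) {ax : Bool → Fin 3}
    (hax : ∀ b, IsGateOn (gate τ b) (ax b)) (b : Bool) :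
    ∃ y, HasSigns y (T.subSigns b) ∧
      ∀ m, y m = 2 * gate τ b m - ((T.gateSigns b m : ℤ) : ℝ) / 2 := by
  cases b
  · refine ⟨_, T.hasSigns_map 0 (h.hasSigns_gate hax _), fun m => ?_⟩
    have := congrArg (· m) h.gate_false
    simp only [T.toSub_apply] at this
    rw [this]
    simp only [Traversal.gateSigns, pair, cond_false, Traversal.code]
    ring
  · refine ⟨_, T.hasSigns_map 7 (h.hasSigns_gate hax _), fun m => ?_⟩
    have := congrArg (· m) h.gate_true
    simp only [T.toSub_apply] at this
    rw [this]
    simp only [Traversal.gateSigns, pair, cond_true, Traversal.code]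
    ring

theorem Traversal.Traces.joint (h : T.Traces τ) {ax : Bool → Fin 3}
    (hax : ∀ b, IsGateOn (gate τ b) (ax b)) (i : Fin 7) :
    Joint ax T.gateSigns T.subSigns (T.octant i.castSucc) (T.octant i.succ)
      (T.code i.castSucc) (T.code i.succ) := by
  have key := gates_of_common (hax _) (hax _) (h.gate_joint i)
  have hs := fun j b => T.hasSigns_map j (h.hasSigns_gate hax b)
  have agree : AgreeOff (T.octant i.castSucc) (T.octant i.succ)
      ((T.code i.castSucc).act (T.gateSigns (!(T.code i.castSucc).rev)))
      ((T.code i.succ).act (T.gateSigns (T.code i.succ).rev)) := fun m hm => by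
    have h1 := hs i.castSucc (!(T.code i.castSucc).rev) m
    have h2 := hs i.succ (T.code i.succ).rev m
    simp only [Traversal.code] at h1 h2
    rw [(key m).2 hm] at h1
    exact unit_eq_of_mul_pos h1 h2
  refine ⟨fun m hm => ((key m).1 hm).1, fun m hm => ((key m).1 hm.symm).2.1,
    fun m hm => unit_eq_of_mul_pos (hs _ _ m) ((key m).1 hm).2.2.1,
    fun m hm => unit_eq_of_mul_pos (hs _ _ m) ((key m).1 hm.symm).2.2.2, agree, fun m hm => ?_⟩
  obtain ⟨y, hy, hy'⟩ := h.exists_sub hax (!(T.code i.castSucc).rev)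
  obtain ⟨z, hz, hz'⟩ := h.exists_sub hax (T.code i.succ).rev
  have h1 := T.hasSigns_map i.castSucc hy m
  have h2 := T.hasSigns_map i.succ hz m
  -- Magnification doubles a coordinate and subtracts half its sign. Coordinates and first-level
  -- signs agree off the separating axis, hence so do the magnified coordinates.
  have heq : (T.symm i.castSucc).map y m = (T.symm i.succ).map z m := by
    have e1 := (key m).2 hm
    have e2 := congrArg (fun u : ℤˣ => ((u : ℤ) : ℝ)) (agree m hm)
    simp only [RowCode.act, Units.val_mul, Int.cast_mul] at e2
    rw [CubeSymm.map_apply, CubeSymm.map_apply] at e1 ⊢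
    rw [hy', hz']
    simp only [Traversal.code] at e2 ⊢
    linear_combination 2 * e1 - e2 / 2
  rw [heq] at h1
  exact unit_eq_of_mul_pos h1 h2

/-! ### Applying the search to a traversal -/

theorem AllCodes.apply {A : (Fin 3 → Fin 3) → Bool → Prop} {P : RowCode → Prop}
    (h : AllCodes A P) (T : Traversal) (i : Fin 8) (hA : A (T.code i).src (T.code i).rev) :
    P (T.code i) := by
  obtain ⟨k, hk⟩ := exists_axisPerm (T.symm i).perm.symm
  obtain ⟨l, hl⟩ := exists_signVector (T.code i).sgn
  have hk' : (T.code i).src = axisPerm k := hk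
  have hc : T.code i = ⟨axisPerm k, signVector l, (T.code i).rev⟩ := by
    rw [← hk', ← hl]
  rw [hc]
  rw [hk'] at hA
  exact h k _ hA l

theorem Traversal.Traces.exists_octantPath (h : T.Traces τ) {ax : Bool → Fin 3}
    (hax : ∀ b, IsGateOn (gate τ b) (ax b)) (h₀ : T.octant 0 = ![-1, -1, -1])
    (h₁ : T.octant 1 = ![1, -1, -1]) (h₂ : T.octant 2 = ![1, 1, -1]) :
    ∃ k, T.octant = octantPath k := by
  have adj := h.adjacent hax
  have inj : ∀ {i j : Fin 8}, i ≠ j → T.octant i ≠ T.octant j :=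
    fun hij => T.bijective_octant.injective.ne hij
  obtain ⟨k, hk⟩ := exists_octantPath_aux (T.octant 3) (h₂ ▸ adj 2)
    (by rw [← h₀, ← h₁]; simp [inj])
    (T.octant 4) (adj 3) (by rw [← h₀, ← h₁, ← h₂]; simp [inj])
    (T.octant 5) (adj 4) (by rw [← h₀, ← h₁, ← h₂]; simp [inj])
    (T.octant 6) (adj 5) (by rw [← h₀, ← h₁, ← h₂]; simp [inj])
    (T.octant 7) (adj 6) (by rw [← h₀, ← h₁, ← h₂]; simp [inj])
  refine ⟨k, ?_⟩
  rw [← hk, ← h₀, ← h₁, ← h₂]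
  funext i
  fin_cases i <;> rfl

/-- With this code the entrance gate `p` is a fixed point: `p 0 = -1/4 + p 2 / 2` and `p 2 = -1/4 +
p 0 / 2`. Both coordinates are then -1/2, which a facet gate does not allow. -/
theorem Traversal.Traces.code_zero_ne (h : T.Traces τ) {ax : Bool → Fin 3}
    (hax : ∀ b, IsGateOn (gate τ b) (ax b)) (h₀ : T.octant 0 = ![-1, -1, -1]) :
    T.code 0 ≠ edgeFirst := by
  intro hc
  have hp : ∀ m, gate τ false m = _ := fun m => by
    rw [h.gate_false, T.toSub_apply, CubeSymm.map_apply]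
  have hsrc : ∀ m, (T.symm 0).perm.symm m = ![2, 1, 0] m := fun m =>
    congrArg (fun c : RowCode => c.src m) hc
  have hsgn : ∀ m, (T.symm 0).sign ((T.symm 0).perm.symm m) = ![1, 1, 1] m := fun m =>
    congrArg (fun c : RowCode => c.sgn m) hc
  have hrev : T.reversed 0 = false := congrArg RowCode.rev hc
  have h0 := hp 0
  have h1 := hp 1
  have h2 := hp 2
  rw [hsgn, hsrc, hrev, h₀] at h0 h1 h2
  simp at h0 h1 h2
  have e0 : |gate τ false 0| = 1 / 2 := by
    rw [show gate τ false 0 = -1 / 2 by linarith]; norm_num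
  have e2 : |gate τ false 2| = 1 / 2 := by
    rw [show gate τ false 2 = -1 / 2 by linarith]; norm_num
  exact absurd (((hax false).eq_of_abs e0).trans ((hax false).eq_of_abs e2).symm) (by decide)

/-- The exit gate `p` satisfies `p 0 = -1/4 - p 2 / 2` and `p 2 = 1/4 - p 0 / 2`, hence `p 0 = -1/2`
and `p 2 = 1/2`: again two extreme coordinates. -/
theorem Traversal.Traces.code_seven_ne (h : T.Traces τ) {ax : Bool → Fin 3}
    (hax : ∀ b, IsGateOn (gate τ b) (ax b)) (h₇ : T.octant 7 = ![-1, -1, 1]) :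
    T.code 7 ≠ edgeLast := by
  intro hc
  have hp : ∀ m, gate τ true m = _ := fun m => by
    rw [h.gate_true, T.toSub_apply, CubeSymm.map_apply]
  have hsrc : ∀ m, (T.symm 7).perm.symm m = ![2, 1, 0] m := fun m =>
    congrArg (fun c : RowCode => c.src m) hc
  have hsgn : ∀ m, (T.symm 7).sign ((T.symm 7).perm.symm m) = ![-1, 1, -1] m := fun m =>
    congrArg (fun c : RowCode => c.sgn m) hc
  have hrev : T.reversed 7 = false := congrArg RowCode.rev hc
  have h0 := hp 0
  have h1 := hp 1
  have h2 := hp 2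
  rw [hsgn, hsrc, hrev, h₇] at h0 h1 h2
  simp at h0 h1 h2
  have e0 : |gate τ true 0| = 1 / 2 := by
    rw [show gate τ true 0 = -1 / 2 by linarith]; norm_num
  have e2 : |gate τ true 2| = 1 / 2 := by
    rw [show gate τ true 2 = 1 / 2 by linarith]; norm_num
  exact absurd (((hax true).eq_of_abs e0).trans ((hax true).eq_of_abs e2).symm) (by decide)

/-- A facet-gated traversal that visits the octants `(-,-,-)`, `(+,-,-)`, `(+,+,-)` first is
Ca00.gs, or its reversal reflected in the last axis. -/
theorem Traversal.Traces.codes_eq (h : T.Traces τ) {ax : Bool → Fin 3}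
    (hax : ∀ b, IsGateOn (gate τ b) (ax b)) (h₀ : T.octant 0 = ![-1, -1, -1])
    (h₁ : T.octant 1 = ![1, -1, -1]) (h₂ : T.octant 2 = ![1, 1, -1]) :
    T.octant = ca00gs.octant ∧
      ((∀ i, T.code i = ca00gs.code i) ∨ ∀ i, T.code i = revCode i) := by
  obtain ⟨k, hk⟩ := h.exists_octantPath hax h₀ h₁ h₂
  have J := h.joint hax
  have hpair : pair (ax false) (ax true) = ax := by funext b; cases b <;> rfl
  have hall : ![T.code 0, T.code 1, T.code 2, T.code 3, T.code 4, T.code 5, T.code 6, T.code 7] =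
      T.code := by
    funext i; fin_cases i <;> rfl
  have hs : T.gateSigns = pair (octantPath k 0) (octantPath k 7) := by rw [← hk]; rfl
  have ht : T.subSigns = pair ((T.code 0).act (T.gateSigns (T.code 0).rev))
    ((T.code 7).act (T.gateSigns (!(T.code 7).rev))) := rfl
  have ef := h.end_false_sign hax
  have et := h.end_true_sign hax
  have search := codes_of_octantPath k (ax false) (ax true)
  simp only [hpair, ← hk] at search
  have hs' : pair (T.octant 0) (T.octant 7) = T.gateSigns := rfl
  rw [hs'] at search
  have search := (search.apply T 0 ⟨(h.end_false hax).1, (J 0).exitAxis⟩) ef (J 0).exitSign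
  have search := (search.apply T 7 ⟨(h.end_true hax).1, (J 6).enterAxis⟩) et (J 6).enterSign
  rw [← ht] at search
  have S : ∀ i : Fin 7, SignsOK T.gateSigns T.subSigns (T.octant i.castSucc) (T.octant i.succ)
      (T.code i.castSucc) (T.code i.succ) := fun i =>
    ⟨(J i).enterSign, (J i).agree₁, (J i).agree₂⟩
  have search := (search.apply T 1 ⟨(J 0).enterAxis, (J 1).exitAxis⟩) (S 0) (J 1).exitSign
  have search := (search.apply T 2 ⟨(J 1).enterAxis, (J 2).exitAxis⟩) (S 1) (J 2).exitSign
  have search := (search.apply T 3 ⟨(J 2).enterAxis, (J 3).exitAxis⟩) (S 2) (J 3).exitSign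
  have search := (search.apply T 4 ⟨(J 3).enterAxis, (J 4).exitAxis⟩) (S 3) (J 4).exitSign
  have search := (search.apply T 5 ⟨(J 4).enterAxis, (J 5).exitAxis⟩) (S 4) (J 5).exitSign
  have search := (search.apply T 6 ⟨(J 5).enterAxis, (J 6).exitAxis⟩) (S 5) (J 6).exitSign (S 6)
  rw [hall] at search
  obtain ⟨rfl, hc⟩ := search
  refine ⟨hk, ?_⟩
  rcases hc with hc | hc | hc | hc
  · exact absurd hc (h.code_zero_ne hax h₀)
  · exact absurd hc (h.code_seven_ne hax (by rw [hk]; rfl))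
  · exact Or.inl hc
  · exact Or.inr hc

/-! ### The group of symmetries of the cube -/

namespace CubeSymm

/-- The composition of two symmetries. -/
def comp (γ δ : CubeSymm) : CubeSymm :=
  ⟨δ.perm.trans γ.perm, fun j => δ.sign j * γ.sign (δ.perm j)⟩

/-- The inverse symmetry. -/
def inv (γ : CubeSymm) : CubeSymm := ⟨γ.perm.symm, fun j => γ.sign (γ.perm.symm j)⟩

/-- The action of a symmetry on sign vectors. -/
def actSigns (γ : CubeSymm) (s : Fin 3 → ℤˣ) (i : Fin 3) : ℤˣ :=
  γ.sign (γ.perm.symm i) * s (γ.perm.symm i)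

theorem map_comp (γ δ : CubeSymm) (x : E3) : (γ.comp δ).map x = γ.map (δ.map x) := by
  ext i
  simp only [map_apply, comp, Equiv.symm_trans_apply, Equiv.apply_symm_apply, Units.val_mul,
    Int.cast_mul]
  ring

theorem unit_mul_self (u : ℤˣ) : ((u : ℤ) : ℝ) * ((u : ℤ) : ℝ) = 1 := by
  rcases cast_unit u with h | h <;> rw [h] <;> norm_num

theorem map_inv_map (γ : CubeSymm) (x : E3) : γ.inv.map (γ.map x) = x := by
  ext i
  simp only [map_apply, inv, Equiv.symm_symm, Equiv.symm_apply_apply]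
  rw [← mul_assoc, unit_mul_self, one_mul]

theorem map_map_inv (γ : CubeSymm) (x : E3) : γ.map (γ.inv.map x) = x := by
  ext i
  simp only [map_apply, inv, Equiv.symm_symm, Equiv.apply_symm_apply]
  rw [← mul_assoc, unit_mul_self, one_mul]

theorem map_toOctant (γ : CubeSymm) (v : Fin 3 → ℤˣ) (x : E3) :
    γ.map (toOctant v x) = toOctant (γ.actSigns v) (γ.map x) := by
  ext i
  simp only [map_apply, toOctant_apply, actSigns, Units.val_mul, Int.cast_mul]
  ring

theorem actSigns_inv (γ : CubeSymm) (s : Fin 3 → ℤˣ) : γ.actSigns (γ.inv.actSigns s) = s := by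
  funext i
  simp only [actSigns, inv, Equiv.symm_symm, Equiv.apply_symm_apply]
  rw [← mul_assoc, Int.units_mul_self, one_mul]

theorem inv_actSigns (γ : CubeSymm) (s : Fin 3 → ℤˣ) : γ.inv.actSigns (γ.actSigns s) = s := by
  funext i
  simp only [actSigns, inv, Equiv.symm_symm, Equiv.symm_apply_apply]
  rw [← mul_assoc, Int.units_mul_self, one_mul]

theorem map_mem_cube (γ : CubeSymm) {x : E3} (hx : x ∈ cube) : γ.map x ∈ cube := fun j => by
  rw [γ.abs_map_apply]; exact hx _

theorem image_cube (γ : CubeSymm) : γ.map '' cube = cube := by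
  apply Set.Subset.antisymm
  · rintro _ ⟨x, hx, rfl⟩; exact γ.map_mem_cube hx
  · exact fun x hx => ⟨γ.inv.map x, γ.inv.map_mem_cube hx, γ.map_map_inv x⟩

theorem continuous_map (γ : CubeSymm) : Continuous γ.map := by
  unfold map
  fun_prop

end CubeSymm

theorem isFacetGate_map {p : E3} (h : IsFacetGate p) (γ : CubeSymm) : IsFacetGate (γ.map p) := by
  rw [isFacetGate_iff] at h ⊢
  obtain ⟨j, hj⟩ := h
  exact ⟨_, hj.map γ⟩

/-! ### Conjugation and reversal -/

/-- The traversal of the image of a curve under a symmetry. -/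
def Traversal.conj (T : Traversal) (γ : CubeSymm) : Traversal where
  octant i := γ.actSigns (T.octant i)
  bijective_octant := by
    refine Function.Bijective.comp (g := γ.actSigns) ?_ T.bijective_octant
    exact Function.bijective_iff_has_inverse.2 ⟨_, γ.inv_actSigns, γ.actSigns_inv⟩
  symm i := (γ.comp (T.symm i)).comp γ.inv
  reversed := T.reversed

/-- The traversal of the reversal of a curve. -/
def Traversal.reverse (T : Traversal) : Traversal where
  octant i := T.octant i.rev
  bijective_octant := T.bijective_octant.comp Fin.rev_bijective
  symm i := T.symm i.rev
  reversed i := T.reversed i.rev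

variable {T' : Traversal} {τ' : unitInterval → E3}

theorem Traversal.conj_toSub (T : Traversal) (γ : CubeSymm) (i : Fin 8) (x : E3) :
    (T.conj γ).toSub i x = γ.map (T.toSub i (γ.inv.map x)) := by
  simp only [Traversal.toSub, CubeSymm.map_toOctant, Traversal.conj, CubeSymm.map_comp]

theorem Traversal.Traces.conj (h : T.Traces τ) (γ : CubeSymm) :
    (T.conj γ).Traces fun t => γ.map (τ t) where
  continuous := γ.continuous_map.comp h.continuous
  octant_based i := by
    have h1 : (fun t => γ.map (τ t)) '' Set.range (segment i) =
        γ.map '' (τ '' Set.range (segment i)) := (Set.image_image _ _ _).symm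
    rw [h1, h.octant_based, Set.image_image]
    simp only [CubeSymm.map_toOctant]
    rw [← Set.image_image (toOctant _) γ.map, γ.image_cube]
    rfl
  self_similar i t := by
    rw [T.conj_toSub, γ.map_inv_map, h.self_similar]
    rfl

theorem symm_segment (i : Fin 8) (t : unitInterval) :
    unitInterval.symm (segment i t) = segment i.rev (unitInterval.symm t) := by
  ext
  have hi : ((i.rev : ℕ) : ℝ) = 7 - ((i : ℕ) : ℝ) := by
    have : (i.rev : ℕ) + (i : ℕ) = 7 := by
      rw [Fin.val_rev]; omega
    rw [eq_sub_iff_add_eq]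
    exact_mod_cast this
  simp only [unitInterval.coe_symm_eq, segment, hi]
  ring

theorem Traversal.Traces.reverse (h : T.Traces τ) :
    T.reverse.Traces fun t => τ (unitInterval.symm t) where
  continuous := h.continuous.comp unitInterval.continuous_symm
  octant_based i := by
    rw [show T.reverse.octant i = T.octant i.rev from rfl, ← h.octant_based i.rev]
    ext x
    simp only [Set.mem_image, Set.mem_range, exists_exists_eq_and, symm_segment]
    exact ⟨fun ⟨a, ha⟩ => ⟨_, ha⟩, fun ⟨a, ha⟩ => ⟨unitInterval.symm a, by simpa using ha⟩⟩
  self_similar i t := by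
    rw [symm_segment, h.self_similar]
    simp only [Traversal.reverse, Traversal.toSub]
    by_cases hr : T.reversed i.rev = true <;> simp [hr]

/-! ### Uniqueness of the curve of a traversal -/

theorem exists_segment (t : unitInterval) : ∃ i s, t = segment i s := by
  -- At `t = 1` the floor of `8 * t` is 8, which is not an octant index.
  rcases eq_or_ne t 1 with rfl | ht
  · exact ⟨7, 1, segment_seven_one.symm⟩
  have h0 := t.2.1
  have h1 : (t : ℝ) < 1 := lt_of_le_of_ne t.2.2 fun h => ht (Subtype.ext h)
  have hf := Nat.floor_le (a := 8 * (t : ℝ)) (by linarith)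
  have hf' := Nat.lt_floor_add_one (8 * (t : ℝ))
  have h8 : ⌊8 * (t : ℝ)⌋₊ < 8 := by
    rw [Nat.floor_lt (by linarith)]
    push_cast
    linarith
  refine ⟨⟨_, h8⟩, ⟨8 * (t : ℝ) - ⌊8 * (t : ℝ)⌋₊, by linarith, by linarith⟩, ?_⟩
  ext
  simp [segment]

theorem toOctant_mem_cube (v : Fin 3 → ℤˣ) {x : E3} (hx : x ∈ cube) : toOctant v x ∈ cube := by
  intro j
  have := abs_le.1 (hx j)
  rw [toOctant_apply, abs_le]
  rcases cast_unit (v j) with h | h <;> rw [h] <;> constructor <;> linarith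

theorem Traversal.Traces.mem_cube (h : T.Traces τ) (t : unitInterval) : τ t ∈ cube := by
  obtain ⟨i, s, rfl⟩ := exists_segment t
  have : τ (segment i s) ∈ τ '' Set.range (segment i) := ⟨_, ⟨s, rfl⟩, rfl⟩
  rw [h.octant_based] at this
  obtain ⟨x, hx, hx'⟩ := this
  rw [← hx']
  exact toOctant_mem_cube _ hx

theorem Traversal.abs_toSub_sub (T : Traversal) (i : Fin 8) (x y : E3) (m : Fin 3) :
    |T.toSub i x m - T.toSub i y m| =
      1 / 2 * |x ((T.symm i).perm.symm m) - y ((T.symm i).perm.symm m)| := by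
  rw [T.toSub_apply, T.toSub_apply, add_sub_add_left_eq_sub, ← mul_sub, abs_mul,
    CubeSymm.map_apply, CubeSymm.map_apply, ← mul_sub, abs_unit_mul]
  norm_num

/-- Both curves lie in the cube, so coordinates differ by at most 1, and each use of self-similarity
halves this bound. -/
theorem Traversal.Traces.unique (h : T.Traces τ) (h' : T'.Traces τ')
    (hsub : ∀ i x, T.toSub i x = T'.toSub i x) (hrev : T.reversed = T'.reversed) : τ = τ' := by
  have key : ∀ (n : ℕ) t m, |τ t m - τ' t m| ≤ (1 / 2) ^ n := by
    intro n
    induction n with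
    | zero =>
      intro t m
      have h1 := abs_le.1 (h.mem_cube t m)
      have h2 := abs_le.1 (h'.mem_cube t m)
      rw [pow_zero, abs_le]
      constructor <;> linarith
    | succ n ih =>
      intro t m
      obtain ⟨i, s, rfl⟩ := exists_segment t
      rw [h.self_similar, h'.self_similar, ← hsub, ← hrev, T.abs_toSub_sub, pow_succ]
      have := ih (if T.reversed i then unitInterval.symm s else s) ((T.symm i).perm.symm m)
      linarith
  funext t
  ext m
  have hlim := tendsto_pow_atTop_nhds_zero_of_lt_one (r := (1 / 2 : ℝ)) (by norm_num)
    (by norm_num)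
  have := ge_of_tendsto' hlim fun n => key n t m
  exact sub_eq_zero.1 (abs_nonpos_iff.1 this)

theorem Traversal.map_eq_of_code {i j : Fin 8} (h : T.code i = T'.code j) (x : E3) :
    (T.symm i).map x = (T'.symm j).map x := by
  have hsrc : ∀ m, (T.symm i).perm.symm m = (T'.symm j).perm.symm m := fun m =>
    congrArg (fun c : RowCode => c.src m) h
  have hsgn : ∀ m, (T.symm i).sign ((T.symm i).perm.symm m) =
      (T'.symm j).sign ((T'.symm j).perm.symm m) := fun m =>
    congrArg (fun c : RowCode => c.sgn m) h
  ext m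
  rw [CubeSymm.map_apply, CubeSymm.map_apply, hsgn, hsrc]

/-! ### Normalization -/

/-- As `a ≠ c`, the two moves have different axes, which can be sent to the first two axes; signs
then fix the starting octant. Here `σ` is the inverse of the permutation of the symmetry. -/
theorem exists_normalizing_aux : ∀ a b c : Fin 8,
    Adjacent (signVector a) (signVector b) → Adjacent (signVector b) (signVector c) → a ≠ c →
    ∃ (σ : Equiv.Perm (Fin 3)) (k : Fin 8),
      (∀ i, signVector k (σ i) * signVector a (σ i) = ![-1, -1, -1] i) ∧
      (∀ i, signVector k (σ i) * signVector b (σ i) = ![1, -1, -1] i) ∧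
      ∀ i, signVector k (σ i) * signVector c (σ i) = ![1, 1, -1] i := by
  decide +kernel

theorem exists_normalizing {u v w : Fin 3 → ℤˣ} (huv : Adjacent u v) (hvw : Adjacent v w)
    (huw : u ≠ w) : ∃ γ : CubeSymm, γ.actSigns u = ![-1, -1, -1] ∧
      γ.actSigns v = ![1, -1, -1] ∧ γ.actSigns w = ![1, 1, -1] := by
  obtain ⟨a, rfl⟩ := exists_signVector u
  obtain ⟨b, rfl⟩ := exists_signVector v
  obtain ⟨c, rfl⟩ := exists_signVector w
  obtain ⟨σ, k, h1, h2, h3⟩ := exists_normalizing_aux a b c huv hvw fun h => huw (h ▸ rfl)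
  exact ⟨⟨σ.symm, signVector k⟩, funext h1, funext h2, funext h3⟩

/-- The reflection in the last axis. -/
def reflectLast : CubeSymm := ⟨Equiv.refl _, ![1, 1, -1]⟩

theorem reflectLast_map_apply (x : E3) (m : Fin 3) :
    reflectLast.map x m = (((![1, 1, -1] : Fin 3 → ℤˣ) m : ℤ) : ℝ) * x m := rfl

theorem reflectLast_inv_map_apply (x : E3) (m : Fin 3) :
    reflectLast.inv.map x m = (((![1, 1, -1] : Fin 3 → ℤˣ) m : ℤ) : ℝ) * x m := rfl

theorem reflectLast_octant_rev : ∀ (i : Fin 8) (m : Fin 3),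
    (![1, 1, -1] : Fin 3 → ℤˣ) m * ca00gs.octant i.rev m = ca00gs.octant i m := by
  decide +kernel

/-- The base pattern is its own reversal reflected in the last axis, and `revCode` is Ca00.gs
conjugated by this reflection in reverse order. Undoing both operations therefore recovers the
pieces of Ca00.gs. -/
theorem toSub_reverse_of_revCode (ho : T.octant = ca00gs.octant) (hc : ∀ i, T.code i = revCode i)
    (i : Fin 8) (x : E3) : (T.conj reflectLast).reverse.toSub i x = ca00gs.toSub i x := by
  have h1 : (T.conj reflectLast).reverse.toSub i x = (T.conj reflectLast).toSub i.rev x := rfl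
  rw [h1, T.conj_toSub]
  ext m
  have hsrc : ∀ m, (T.symm i.rev).perm.symm m = (ca00gs.symm i).perm.symm m := fun m => by
    have := congrArg (fun c : RowCode => c.src m) (hc i.rev)
    simp only [revCode, Fin.rev_rev] at this
    exact this
  have hsgn : ∀ m, (T.symm i.rev).sign ((T.symm i.rev).perm.symm m) =
      ![1, 1, -1] m * (ca00gs.symm i).sign ((ca00gs.symm i).perm.symm m) *
        ![1, 1, -1] ((ca00gs.symm i).perm.symm m) := fun m => by
    have := congrArg (fun c : RowCode => c.sgn m) (hc i.rev)
    simp only [revCode, Fin.rev_rev] at this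
    exact this
  rw [reflectLast_map_apply, T.toSub_apply, ca00gs.toSub_apply, (T.symm i.rev).map_apply,
    (ca00gs.symm i).map_apply, hsgn, hsrc, reflectLast_inv_map_apply, ho, ← reflectLast_octant_rev i m]
  push_cast
  have e1 := CubeSymm.unit_mul_self ((![1, 1, -1] : Fin 3 → ℤˣ) m)
  have e2 := CubeSymm.unit_mul_self ((![1, 1, -1] : Fin 3 → ℤˣ) ((ca00gs.symm i).perm.symm m))
  generalize (((![1, 1, -1] : Fin 3 → ℤˣ) m : ℤ) : ℝ) = a at *
  generalize (((![1, 1, -1] : Fin 3 → ℤˣ) ((ca00gs.symm i).perm.symm m) : ℤ) : ℝ) = b at *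
  generalize (((ca00gs.symm i).sign ((ca00gs.symm i).perm.symm m) : ℤ) : ℝ) = c
  linear_combination 1 / 2 * c * x ((ca00gs.symm i).perm.symm m) * (b * b * e1 + e2)

theorem equivalent_of_isFacetGated {β : unitInterval → E3} (hβ : ca00gs.Traces β)
    (hτ : IsHilbertCurve τ) (hg : IsFacetGated τ) : Equivalent τ β := by
  obtain ⟨T, hT⟩ := hτ
  have hax : ∀ {σ : unitInterval → E3}, IsFacetGated σ →
      ∃ ax : Bool → Fin 3, ∀ b, IsGateOn (gate σ b) (ax b) := fun {σ} hσ => by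
    obtain ⟨j, hj⟩ := (isFacetGate_iff _).1 hσ.1
    obtain ⟨l, hl⟩ := (isFacetGate_iff _).1 hσ.2
    exact ⟨pair j l, fun b => by cases b; exacts [hj, hl]⟩
  obtain ⟨ax, hax₁⟩ := hax hg
  obtain ⟨γ, h₀, h₁, h₂⟩ := exists_normalizing (hT.adjacent hax₁ 0) (hT.adjacent hax₁ 1)
    (T.bijective_octant.injective.ne (by decide))
  obtain ⟨ax', hax₂⟩ := hax (σ := fun t => γ.map (τ t))
    ⟨isFacetGate_map hg.1 γ, isFacetGate_map hg.2 γ⟩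
  obtain ⟨ho, hc | hc⟩ := (hT.conj γ).codes_eq hax₂ h₀ h₁ h₂
  · have heq := (hT.conj γ).unique hβ
      (fun i x => by rw [Traversal.toSub, Traversal.toSub, ho, Traversal.map_eq_of_code (hc i)])
      (funext fun i => congrArg RowCode.rev (hc i))
    exact ⟨γ.inv, Or.inl fun t => by rw [← congrFun heq t, γ.map_inv_map]⟩
  · have heq := ((hT.conj γ).conj reflectLast).reverse.unique hβ
      (toSub_reverse_of_revCode ho hc)
      (funext fun i => by
        have := congrArg RowCode.rev (hc i.rev)
        simp only [revCode, Fin.rev_rev] at this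
        exact this)
    refine ⟨γ.inv.comp reflectLast.inv, Or.inr fun t => ?_⟩
    rw [CubeSymm.map_comp, ← congrFun heq (unitInterval.symm t), unitInterval.symm_symm,
      CubeSymm.map_inv_map, CubeSymm.map_inv_map]

/-! ### Existence of the curve of a traversal -/

/-- The reparametrization of octant `i`. -/
def Traversal.dir (T : Traversal) (i : Fin 8) (t : unitInterval) : unitInterval :=
  if T.reversed i then unitInterval.symm t else t

theorem Traversal.continuous_dir (T : Traversal) (i : Fin 8) : Continuous (T.dir i) := by
  unfold Traversal.dir
  cases T.reversed i
  · simpa using continuous_id'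
  · simpa using unitInterval.continuous_symm

theorem Traversal.continuous_toSub (T : Traversal) (i : Fin 8) : Continuous (T.toSub i) := by
  have := (T.symm i).continuous_map
  unfold Traversal.toSub toOctant
  fun_prop

/-- The end points of the pieces `toSub i` match for curves from `g false` to `g true`. -/
structure Traversal.Compatible (T : Traversal) (g : Bool → E3) : Prop where
  first : g false = T.toSub 0 (g (T.reversed 0))
  last : g true = T.toSub 7 (g (!T.reversed 7))
  joint : ∀ i : Fin 7, T.toSub i.castSucc (g (!T.reversed i.castSucc)) =
    T.toSub i.succ (g (T.reversed i.succ))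

/-- The image of `f` in octant `i`, run through while `t` is in segment `i`, and constant before
and after. -/
noncomputable def Traversal.piece (T : Traversal) (f : unitInterval → E3) (i : Fin 8) (t : unitInterval) : E3 :=
  T.toSub i (f (T.dir i (Set.projIcc 0 1 zero_le_one (8 * (t : ℝ) - (i : ℕ)))))

/-- The concatenation of the images of `f` in the octants. -/
noncomputable def Traversal.refine (T : Traversal) (f : unitInterval → E3) (t : unitInterval) : E3 :=
  f 0 + ∑ i, (T.piece f i t - T.piece f i 0)

/-- Each clamped piece is continuous on the whole interval, so writing the concatenation as a sum of
increments avoids gluing. -/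
theorem Traversal.continuous_refine (T : Traversal) {f : unitInterval → E3} (hf : Continuous f) :
    Continuous (T.refine f) := by
  have h : ∀ i, Continuous (T.piece f i) := fun i => by
    have h1 := T.continuous_dir i
    have h2 := T.continuous_toSub i
    unfold Traversal.piece
    refine h2.comp (hf.comp (h1.comp (continuous_projIcc.comp ?_)))
    fun_prop
  unfold Traversal.refine
  exact continuous_const.add (continuous_finsetSum _ fun i _ => (h i).sub continuous_const)

theorem projIcc_segment_of_lt {i j : Fin 8} (h : j < i) (t : unitInterval) :
    Set.projIcc (0 : ℝ) 1 zero_le_one (8 * (segment i t : ℝ) - (j : ℕ)) = 1 := by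
  apply Set.projIcc_of_right_le
  have h1 : ((j : ℕ) : ℝ) + 1 ≤ (i : ℕ) := by exact_mod_cast h
  have h2 := t.2.1
  simp only [segment]
  linarith

theorem projIcc_segment_of_gt {i j : Fin 8} (h : i < j) (t : unitInterval) :
    Set.projIcc (0 : ℝ) 1 zero_le_one (8 * (segment i t : ℝ) - (j : ℕ)) = 0 := by
  apply Set.projIcc_of_le_left
  have h1 : ((i : ℕ) : ℝ) + 1 ≤ (j : ℕ) := by exact_mod_cast h
  have h2 := t.2.2
  simp only [segment]
  linarith

theorem projIcc_segment (i : Fin 8) (t : unitInterval) :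
    Set.projIcc (0 : ℝ) 1 zero_le_one (8 * (segment i t : ℝ) - (i : ℕ)) = t := by
  have : 8 * (segment i t : ℝ) - (i : ℕ) = t := by simp only [segment]; ring
  rw [this, Set.projIcc_val]

/-- In segment `i`, earlier pieces contribute their full increments, later ones nothing, and
matching end points make the sum telescope. -/
theorem Traversal.Compatible.refine_segment {f : unitInterval → E3}
    (h : T.Compatible (gate f)) (i : Fin 8) (t : unitInterval) :
    T.refine f (segment i t) = T.toSub i (f (T.dir i t)) := by
  have d0 : ∀ j, T.toSub j (f (T.dir j 0)) = T.toSub j (gate f (T.reversed j)) := fun j => by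
    unfold Traversal.dir gate; cases T.reversed j <;> simp
  have d1 : ∀ j, T.toSub j (f (T.dir j 1)) = T.toSub j (gate f (!T.reversed j)) := fun j => by
    unfold Traversal.dir gate; cases T.reversed j <;> simp
  have p0 : ∀ j, T.piece f j 0 = T.toSub j (gate f (T.reversed j)) := fun j => by
    have hj : 8 * ((0 : unitInterval) : ℝ) - (j : ℕ) ≤ 0 := by
      rw [Set.Icc.coe_zero, mul_zero, zero_sub]
      exact neg_nonpos.2 (Nat.cast_nonneg _)
    rw [← d0, Traversal.piece, Set.projIcc_of_le_left _ hj]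
    rfl
  have hp : ∀ j, T.piece f j (segment i t) = if j < i then T.toSub j (gate f (!T.reversed j))
      else if i < j then T.toSub j (gate f (T.reversed j)) else T.toSub i (f (T.dir i t)) := by
    intro j
    split_ifs with h1 h2
    · rw [← d1, Traversal.piece, projIcc_segment_of_lt h1]
    · rw [← d0, Traversal.piece, projIcc_segment_of_gt h2]
    · obtain rfl : j = i := le_antisymm (not_lt.1 h2) (not_lt.1 h1)
      rw [Traversal.piece, projIcc_segment]
  have hf : f 0 = T.toSub 0 (gate f (T.reversed 0)) := h.first
  have J0 : T.toSub 0 (gate f (!T.reversed 0)) = T.toSub 1 (gate f (T.reversed 1)) := h.joint 0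
  have J1 : T.toSub 1 (gate f (!T.reversed 1)) = T.toSub 2 (gate f (T.reversed 2)) := h.joint 1
  have J2 : T.toSub 2 (gate f (!T.reversed 2)) = T.toSub 3 (gate f (T.reversed 3)) := h.joint 2
  have J3 : T.toSub 3 (gate f (!T.reversed 3)) = T.toSub 4 (gate f (T.reversed 4)) := h.joint 3
  have J4 : T.toSub 4 (gate f (!T.reversed 4)) = T.toSub 5 (gate f (T.reversed 5)) := h.joint 4
  have J5 : T.toSub 5 (gate f (!T.reversed 5)) = T.toSub 6 (gate f (T.reversed 6)) := h.joint 5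
  have J6 : T.toSub 6 (gate f (!T.reversed 6)) = T.toSub 7 (gate f (T.reversed 7)) := h.joint 6
  rw [Traversal.refine, hf]
  simp only [Fin.sum_univ_eight, p0, hp, J0, J1, J2, J3, J4, J5, J6]
  clear hp p0 d0 d1 J0 J1 J2 J3 J4 J5 J6 hf
  generalize T.toSub i (f (T.dir i t)) = x
  fin_cases i <;> simp

theorem Traversal.Compatible.gate_refine {f : unitInterval → E3}
    (h : T.Compatible (gate f)) (b : Bool) : gate (T.refine f) b = gate f b := by
  cases b
  · rw [h.first, gate, cond_false, ← segment_zero_zero, h.refine_segment]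
    unfold Traversal.dir gate; cases T.reversed 0 <;> simp
  · rw [h.last, gate, cond_true, ← segment_seven_one, h.refine_segment]
    unfold Traversal.dir gate; cases T.reversed 7 <;> simp

/-- The curves from `g false` to `g true`. -/
def curvesBetween (g : Bool → E3) : Set C(unitInterval, E3) := {f | gate f = g}

theorem isClosed_curvesBetween (g : Bool → E3) : IsClosed (curvesBetween g) := by
  have : curvesBetween g = ⋂ b, {f | f (cond b 1 0) = g b} := by
    ext f; simp [curvesBetween, funext_iff, gate]
  rw [this]
  exact isClosed_iInter fun b =>
    isClosed_singleton.preimage (continuous_eval_const _)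

theorem nonempty_curvesBetween (g : Bool → E3) : (curvesBetween g).Nonempty := by
  refine ⟨⟨fun t => g false + (t : ℝ) • (g true - g false), by fun_prop⟩, ?_⟩
  funext b
  cases b <;> simp [gate]

theorem CubeSymm.dist_map (γ : CubeSymm) (x y : E3) : dist (γ.map x) (γ.map y) = dist x y := by
  rw [EuclideanSpace.dist_eq, EuclideanSpace.dist_eq]
  congr 1
  have h : ∀ i, dist (γ.map x i) (γ.map y i) ^ 2 =
      (fun j => dist (x j) (y j) ^ 2) (γ.perm.symm i) := fun i => by
    simp only [Real.dist_eq, γ.map_apply, ← mul_sub, abs_unit_mul]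
  rw [Finset.sum_congr rfl fun i _ => h i]
  exact Equiv.sum_comp γ.perm.symm fun j => dist (x j) (y j) ^ 2

theorem Traversal.dist_toSub (T : Traversal) (i : Fin 8) (x y : E3) :
    dist (T.toSub i x) (T.toSub i y) = 1 / 2 * dist x y := by
  rw [Traversal.toSub, Traversal.toSub, toOctant, toOctant, dist_add_left, dist_smul₀,
    CubeSymm.dist_map]
  norm_num

/-- A traversal with matching end points has a continuous self-similar curve. -/
theorem Traversal.exists_selfSimilar (T : Traversal) {g : Bool → E3} (hg : T.Compatible g) :
    ∃ τ : unitInterval → E3, Continuous τ ∧ gate τ = g ∧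
      ∀ i t, τ (segment i t) = T.toSub i (τ (T.dir i t)) := by
  have hcompat : ∀ f : curvesBetween g, T.Compatible (gate f) := fun f => by
    rw [show gate f = g from f.2]; exact hg
  let Φ : curvesBetween g → curvesBetween g := fun f =>
    ⟨⟨T.refine f, T.continuous_refine f.1.continuous⟩,
      funext fun b => ((hcompat f).gate_refine b).trans (congrFun f.2 b)⟩
  -- At each time both refined curves are in the same octant, where the same similarity of ratio 1/2
  -- is applied to them.
  have hΦ : ContractingWith (1 / 2) Φ := by
    refine ⟨by norm_num, LipschitzWith.of_dist_le_mul fun f f' => ?_⟩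
    rw [Subtype.dist_eq, ContinuousMap.dist_le (by positivity)]
    intro t
    obtain ⟨i, s, rfl⟩ := exists_segment t
    change dist (T.refine f (segment i s)) (T.refine f' (segment i s)) ≤ _
    rw [(hcompat f).refine_segment, (hcompat f').refine_segment, T.dist_toSub]
    have := ContinuousMap.dist_apply_le_dist (f := f.1) (g := f'.1) (T.dir i s)
    rw [Subtype.dist_eq]
    push_cast
    linarith
  have := (nonempty_curvesBetween g).to_subtype
  have := (isClosed_curvesBetween g).completeSpace_coe
  have hfix := hΦ.fixedPoint_isFixedPt
  set f := hΦ.fixedPoint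
  refine ⟨f.1, f.1.continuous, f.2, fun i t => ?_⟩
  have h1 : T.refine f (segment i t) = f.1 (segment i t) :=
    congrArg (fun h : curvesBetween g => h.1 (segment i t)) hfix
  rw [← h1, (hcompat f).refine_segment]

/-! ### The curve fills the cube -/

theorem exists_toOctant {x : E3} (hx : x ∈ cube) : ∃ v, ∃ y ∈ cube, x = toOctant v y := by
  refine ⟨fun j => if 0 ≤ x j then 1 else -1,
    WithLp.toLp 2 fun j => 2 * x j - (if 0 ≤ x j then 1 else -1) / 2, fun j => ?_, ?_⟩
  · have := abs_le.1 (hx j)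
    rw [abs_le]
    show _ ≤ 2 * x j - _ ∧ 2 * x j - _ ≤ _
    split_ifs <;> constructor <;> linarith
  · ext j
    rw [toOctant_apply]
    show x j = _ + 1 / 2 * (2 * x j - _)
    split_ifs <;> push_cast <;> ring

theorem Traversal.exists_toSub (T : Traversal) {x : E3} (hx : x ∈ cube) :
    ∃ i, ∃ y ∈ cube, x = T.toSub i y := by
  obtain ⟨v, y, hy, rfl⟩ := exists_toOctant hx
  obtain ⟨i, rfl⟩ := T.bijective_octant.surjective v
  exact ⟨i, _, (T.symm i).inv.map_mem_cube hy, by rw [Traversal.toSub, CubeSymm.map_map_inv]⟩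

theorem Traversal.dir_dir (T : Traversal) (i : Fin 8) (t : unitInterval) :
    T.dir i (T.dir i t) = t := by
  unfold Traversal.dir; cases T.reversed i <;> simp

/-- Any excess of the curve beyond the cube halves at each level, and so does the distance from a
point of the cube to the curve. The range is compact, hence closed, so approximation suffices. -/
theorem Traversal.range_eq_cube (T : Traversal) {τ : unitInterval → E3} (hc : Continuous τ)
    (hτ : ∀ i t, τ (segment i t) = T.toSub i (τ (T.dir i t))) : Set.range τ = cube := by
  obtain ⟨M, hM⟩ := (isCompact_range hc).isBounded.exists_norm_le
  have hM' : ∀ t, ‖τ t‖ ≤ M := fun t => hM _ ⟨t, rfl⟩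
  have hM0 : 0 ≤ M := (norm_nonneg _).trans (hM' 0)
  have hpow := tendsto_pow_atTop_nhds_zero_of_lt_one (r := (1 / 2 : ℝ)) (by norm_num)
    (by norm_num)
  apply Set.Subset.antisymm
  · have key : ∀ (n : ℕ) t j, |τ t j| ≤ 1 / 2 + M * (1 / 2) ^ n := by
      intro n
      induction n with
      | zero =>
        intro t j
        have := (PiLp.norm_apply_le (τ t) j).trans (hM' t)
        rw [Real.norm_eq_abs] at this
        rw [pow_zero]
        linarith
      | succ n ih =>
        intro t j
        obtain ⟨i, s, rfl⟩ := exists_segment t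
        rw [hτ, T.toSub_apply]
        have h1 := ih (T.dir i s) ((T.symm i).perm.symm j)
        rw [← CubeSymm.abs_map_apply, abs_le] at h1
        rw [pow_succ, abs_le]
        rcases cast_unit (T.octant i j) with h | h <;> rw [h] <;> constructor <;> linarith
    rintro _ ⟨t, rfl⟩ j
    have hlim := (hpow.const_mul M).const_add (1 / 2)
    rw [mul_zero, add_zero] at hlim
    exact ge_of_tendsto' hlim fun n => key n t j
  · have key : ∀ (n : ℕ), ∀ x ∈ cube, ∃ t, dist x (τ t) ≤ (M + 2) * (1 / 2) ^ n := by
      intro n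
      induction n with
      | zero =>
        intro x hx
        refine ⟨0, ?_⟩
        have hx' : ‖x‖ ≤ 2 := by
          rw [EuclideanSpace.norm_eq, Real.sqrt_le_left (by norm_num), Fin.sum_univ_three]
          have h : ∀ j, ‖x j‖ ^ 2 ≤ 1 := fun j => by
            rw [Real.norm_eq_abs]
            exact pow_le_one₀ (abs_nonneg _) ((hx j).trans (by norm_num))
          linarith [h 0, h 1, h 2]
        have := dist_le_norm_add_norm x (τ 0)
        rw [pow_zero, mul_one]
        linarith [hM' 0]
      | succ n ih =>
        intro x hx
        obtain ⟨i, y, hy, rfl⟩ := T.exists_toSub hx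
        obtain ⟨t, ht⟩ := ih y hy
        refine ⟨segment i (T.dir i t), ?_⟩
        rw [hτ, T.dir_dir, T.dist_toSub, pow_succ]
        linarith
    intro x hx
    have hcl : IsClosed (Set.range τ) := (isCompact_range hc).isClosed
    rw [← hcl.closure_eq, Metric.mem_closure_iff]
    intro ε hε
    have hlim := hpow.const_mul (M + 2)
    rw [mul_zero] at hlim
    obtain ⟨n, hn⟩ := (hlim.eventually_lt_const hε).exists
    obtain ⟨t, ht⟩ := key n x hx
    exact ⟨_, ⟨t, rfl⟩, ht.trans_lt hn⟩

theorem Traversal.exists_traces (T : Traversal) {g : Bool → E3} (hg : T.Compatible g) :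
    ∃ τ, T.Traces τ ∧ gate τ = g := by
  obtain ⟨τ, hc, hgate, hτ⟩ := T.exists_selfSimilar hg
  refine ⟨τ, ⟨hc, fun i => ?_, hτ⟩, hgate⟩
  have h1 : τ '' Set.range (segment i) = T.toSub i '' Set.range τ := by
    ext x
    simp only [Set.mem_image, Set.mem_range, exists_exists_eq_and, hτ]
    exact ⟨fun ⟨t, ht⟩ => ⟨_, ht⟩, fun ⟨t, ht⟩ => ⟨T.dir i t, by rw [T.dir_dir, ht]⟩⟩
  rw [h1, T.range_eq_cube hc hτ]
  unfold Traversal.toSub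
  rw [← Set.image_image (toOctant _) (T.symm i).map, CubeSymm.image_cube]

/-! ### The curve Ca00.gs -/

theorem ca00gs_toSub (x : E3) (i : Fin 8) : ca00gs.toSub i x =
    (![!₂[-(1 / 4) - x 1 / 2, -(1 / 4) - x 2 / 2, -(1 / 4) - x 0 / 2],
      !₂[1 / 4 - x 2 / 2, -(1 / 4) - x 1 / 2, -(1 / 4) - x 0 / 2],
      !₂[1 / 4 - x 2 / 2, 1 / 4 + x 1 / 2, -(1 / 4) - x 0 / 2],
      !₂[-(1 / 4) + x 2 / 2, 1 / 4 + x 0 / 2, -(1 / 4) - x 1 / 2],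
      !₂[-(1 / 4) + x 2 / 2, 1 / 4 + x 0 / 2, 1 / 4 + x 1 / 2],
      !₂[1 / 4 - x 2 / 2, 1 / 4 + x 1 / 2, 1 / 4 + x 0 / 2],
      !₂[1 / 4 - x 2 / 2, -(1 / 4) - x 1 / 2, 1 / 4 + x 0 / 2],
      !₂[-(1 / 4) - x 1 / 2, -(1 / 4) - x 0 / 2, 1 / 4 + x 2 / 2]] : Fin 8 → E3) i := by
  ext m
  rw [Traversal.toSub_apply, CubeSymm.map_apply]
  fin_cases i <;> fin_cases m <;> simp [ca00gs, perm] <;> ring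

/-- The gates of Ca00.gs. -/
noncomputable def ca00gsGate : Bool → E3 := pair !₂[-1 / 6, -1 / 2, -1 / 6] !₂[-1 / 6, -1 / 6, 1 / 2]

/-- The last octant is forward, so the exit gate is the fixed point of its map; the first is
reversed, so the entrance gate is the image of the exit gate. -/
theorem ca00gs_compatible : ca00gs.Compatible ca00gsGate where
  first := by
    rw [ca00gs_toSub]
    ext m
    fin_cases m <;> simp [ca00gs, ca00gsGate, pair] <;> norm_num
  last := by
    rw [ca00gs_toSub]
    ext m
    fin_cases m <;> simp [ca00gs, ca00gsGate, pair] <;> norm_num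
  joint i := by
    rw [ca00gs_toSub, ca00gs_toSub]
    ext m
    fin_cases i <;> fin_cases m <;> simp [ca00gs, ca00gsGate, pair] <;> norm_num

theorem isGateOn_ca00gsGate (b : Bool) : IsGateOn (ca00gsGate b) (pair 1 2 b) := by
  cases b <;> refine ⟨by simp [ca00gsGate, pair, abs_div], fun l hl => ?_⟩ <;>
    fin_cases l <;> simp [ca00gsGate, pair, abs_div] at hl ⊢ <;> norm_num

/-! ### Approximating curves and well-foldedness -/

theorem Traversal.vertex_succ (T : Traversal) (k : ℕ) (b : Fin 8) {j : ℕ} (hj : j < 8 ^ k) :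
    T.vertex (k + 1) (b * 8 ^ k + j) =
      T.toSub b (T.vertex k (if T.reversed b then 8 ^ k - 1 - j else j)) := by
  have h1 : ((b : ℕ) * 8 ^ k + j) / 8 ^ k = b := by
    rw [mul_comm, Nat.mul_add_div (by positivity), Nat.div_eq_of_lt hj, add_zero]
  have h2 : ((b : ℕ) * 8 ^ k + j) % 8 ^ k = j := by
    rw [mul_comm, Nat.mul_add_mod, Nat.mod_eq_of_lt hj]
  rw [Traversal.vertex]
  simp only [h1, h2, Fin.ofNat_eq_cast, Fin.cast_val_eq_self]

theorem Traversal.vertex_one (T : Traversal) (i : Fin 8) :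
    T.vertex 1 i = octantCentre (T.octant i) := by
  have h := T.vertex_succ 0 i (j := 0) (by norm_num)
  rw [pow_zero, mul_one, add_zero, zero_add] at h
  rw [h]
  ext m
  rw [T.toSub_apply, CubeSymm.map_apply, octantCentre_apply]
  simp [Traversal.vertex]

theorem wellFoldedOrder_three : wellFoldedOrder 3 = (List.finRange 8).map ca00gs.octant := by
  decide +kernel

theorem ca00gs_isWellFolded : ca00gs.IsWellFolded := by
  refine ⟨⟨Equiv.refl _, 1⟩, Or.inl ?_⟩
  rw [wellFoldedOrder_three, ← List.map_coe_finRange_eq_range, List.map_map, List.map_map]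
  refine List.map_congr_left fun i _ => ?_
  rw [Function.comp_apply, Function.comp_apply, Traversal.vertex_one]
  ext m
  simp [CubeSymm.map_apply]

/-! ### Hyperorthogonality -/

theorem ParallelToAxis.unique {v : E3} {j l : Fin 3} (hj : ParallelToAxis v j)
    (hl : ParallelToAxis v l) : j = l := by
  by_contra hne
  refine hj.1 ?_
  ext m
  by_cases hm : m = j
  · exact hl.2 m (hm ▸ hne)
  · exact hj.2 m hm

theorem parallelToAxis_iff (v : E3) (j : Fin 3) :
    ParallelToAxis v j ↔ v j ≠ 0 ∧ ∀ l, l ≠ j → v l = 0 := by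
  refine and_congr_left fun h => not_congr ⟨fun hv => by rw [hv]; rfl, fun hv => ?_⟩
  ext m
  by_cases hm : m = j
  · rw [hm, hv]; rfl
  · exact h m hm

theorem parallelToAxis_neg (v : E3) (j : Fin 3) : ParallelToAxis (-v) j ↔ ParallelToAxis v j := by
  simp [parallelToAxis_iff]

theorem Traversal.parallelToAxis_toSub_sub (T : Traversal) (i : Fin 8) (x y : E3) (j : Fin 3) :
    ParallelToAxis (T.toSub i x - T.toSub i y) ((T.symm i).perm j) ↔ ParallelToAxis (x - y) j := by
  have h : ∀ m, (T.toSub i x - T.toSub i y) m = 0 ↔ (x - y) ((T.symm i).perm.symm m) = 0 :=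
    fun m => by
      rw [PiLp.sub_apply, PiLp.sub_apply, ← abs_eq_zero, T.abs_toSub_sub, ← abs_eq_zero (a := _ - _)]
      simp
  rw [parallelToAxis_iff, parallelToAxis_iff, Ne, h, Equiv.symm_apply_apply]
  refine and_congr_right fun _ => ⟨fun hl l hne => ?_, fun hl l hne => ?_⟩
  · simpa using (h _).1 (hl ((T.symm i).perm l) fun h' => hne ((T.symm i).perm.injective h'))
  · exact (h _).2 (hl _ fun h' => hne (by rw [← h', Equiv.apply_symm_apply]))

/-- Edges within an octant. -/
theorem Traversal.edge_inside (T : Traversal) {k j : ℕ} (b : Fin 8) (hj : j + 1 < 8 ^ k)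
    (a : Fin 3) : ParallelToAxis (T.edge (k + 1) (b * 8 ^ k + j)) ((T.symm b).perm a) ↔
      ParallelToAxis (T.edge k (if T.reversed b then 8 ^ k - 2 - j else j)) a := by
  rw [Traversal.edge, add_assoc, T.vertex_succ k b hj, T.vertex_succ k b (by omega),
    T.parallelToAxis_toSub_sub]
  cases T.reversed b
  · rfl
  -- A reversed octant runs through its `8 ^ k - 1` edges in opposite order and direction.
  · rw [← parallelToAxis_neg, Traversal.edge, neg_sub]
    simp only [if_true]
    rw [show 8 ^ k - 2 - j + 1 = 8 ^ k - 1 - j by omega,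
      show 8 ^ k - 2 - j = 8 ^ k - 1 - (j + 1) by omega]

/-- The first (`false`) or the last (`true`) vertex of an approximating curve. -/
noncomputable def Traversal.endVertex (T : Traversal) (k : ℕ) (b : Bool) : E3 :=
  T.vertex k (cond b (8 ^ k - 1) 0)

/-- Edges between octants. -/
theorem Traversal.edge_between (T : Traversal) (k : ℕ) (b : Fin 7) :
    T.edge (k + 1) (b.castSucc * 8 ^ k + (8 ^ k - 1)) =
      T.toSub b.succ (T.endVertex k (T.reversed b.succ)) -
        T.toSub b.castSucc (T.endVertex k (!T.reversed b.castSucc)) := by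
  have hpos : 0 < 8 ^ k := by positivity
  have h1 : (b.castSucc : ℕ) * 8 ^ k + (8 ^ k - 1) + 1 = (b.succ : ℕ) * 8 ^ k + 0 := by
    rw [Fin.val_succ, Fin.val_castSucc, add_mul, one_mul]
    omega
  rw [Traversal.edge, h1, T.vertex_succ k _ hpos, T.vertex_succ k _ (by omega)]
  unfold Traversal.endVertex
  cases T.reversed b.succ <;> cases T.reversed b.castSucc <;> simp

/-- The end vertices keep the shape of the gates, with `x` and `y` in place of 1/6 and 1/2. The
strict bound on `y` makes the connecting edges non-zero. -/
theorem ca00gs_endVertex (k : ℕ) : ∃ x y : ℝ, y < 1 / 2 ∧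
    ca00gs.endVertex k = pair !₂[-x, -y, -x] !₂[-x, -x, y] := by
  induction k with
  | zero =>
    refine ⟨0, 0, by norm_num, funext fun b => ?_⟩
    ext m
    cases b <;> fin_cases m <;> simp [Traversal.endVertex, Traversal.vertex, pair]
  | succ k ih =>
    obtain ⟨x, y, hy, h⟩ := ih
    refine ⟨1 / 4 - x / 2, 1 / 4 + y / 2, by linarith, funext fun b => ?_⟩
    have hpos : 0 < 8 ^ k := by positivity
    have hlast : ca00gs.vertex k (8 ^ k - 1) = !₂[-x, -x, y] := congrFun h true
    cases b
    · have h0 := ca00gs.vertex_succ k 0 hpos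
      rw [Fin.val_zero, zero_mul, zero_add] at h0
      rw [Traversal.endVertex, cond_false, h0]
      have : ca00gs.reversed 0 = true := rfl
      rw [this, if_pos rfl, Nat.sub_zero, hlast, ca00gs_toSub]
      ext m
      fin_cases m <;> simp [pair] <;> ring
    · have h7 := ca00gs.vertex_succ k 7 (j := 8 ^ k - 1) (by omega)
      rw [show ((7 : Fin 8) : ℕ) * 8 ^ k + (8 ^ k - 1) = 8 ^ (k + 1) - 1 by
        rw [show ((7 : Fin 8) : ℕ) = 7 from rfl, pow_succ]; omega] at h7
      rw [Traversal.endVertex, cond_true, h7]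
      have : ca00gs.reversed 7 = false := rfl
      rw [this, if_neg (by simp), hlast, ca00gs_toSub]
      ext m
      fin_cases m <;> simp [pair] <;> ring

/-- The axes of the moves between the octants of Ca00.gs. -/
def moveAxis : Fin 7 → Fin 3 := ![0, 1, 0, 2, 0, 1, 0]

theorem ca00gs_edge_between (k : ℕ) (b : Fin 7) :
    ParallelToAxis (ca00gs.edge (k + 1) (b.castSucc * 8 ^ k + (8 ^ k - 1))) (moveAxis b) := by
  obtain ⟨x, y, hy, h⟩ := ca00gs_endVertex k
  rw [ca00gs.edge_between, h, ca00gs_toSub, ca00gs_toSub, parallelToAxis_iff]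
  fin_cases b <;> refine ⟨?_, fun l hl => ?_⟩ <;> first
    | (fin_cases l <;> simp [moveAxis, ca00gs, pair] at hl ⊢)
    | (simp [moveAxis, ca00gs, pair]; intro h'; linarith)

/-- The entrance and exit facets are orthogonal to axes 1 and 2; a reversed octant is left through
the image of the entrance facet. -/
theorem ca00gs_perm_exit : ∀ b : Fin 7, (ca00gs.symm b.castSucc).perm
    (if ca00gs.reversed b.castSucc then 1 else 2) = moveAxis b := by
  decide +kernel

theorem ca00gs_perm_enter : ∀ b : Fin 7, (ca00gs.symm b.succ).perm
    (if ca00gs.reversed b.succ then 2 else 1) = moveAxis b := by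
  decide +kernel

/-- Every number below `8 ^ (k + 1)` belongs to a block of length `8 ^ k`. -/
theorem exists_block {k i : ℕ} (hi : i < 8 ^ (k + 1)) :
    ∃ (b : Fin 8) (j : ℕ), j < 8 ^ k ∧ i = b * 8 ^ k + j := by
  have hpos : 0 < 8 ^ k := by positivity
  refine ⟨⟨i / 8 ^ k, ?_⟩, i % 8 ^ k, Nat.mod_lt _ hpos, ?_⟩
  · rw [Nat.div_lt_iff_lt_mul hpos, mul_comm, ← pow_succ]; exact hi
  · rw [mul_comm]; exact (Nat.div_add_mod _ _).symm

/-- The invariants of the approximating curves of Ca00.gs. -/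
structure EdgesOK (k : ℕ) : Prop where
  parallel : ∀ i, i + 1 < 8 ^ k → ∃ j, ParallelToAxis (ca00gs.edge k i) j
  turn : ∀ i, i + 2 < 8 ^ k → ∀ j, ParallelToAxis (ca00gs.edge k i) j →
    ¬ ParallelToAxis (ca00gs.edge k (i + 1)) j
  first : 2 ≤ 8 ^ k → ¬ ParallelToAxis (ca00gs.edge k 0) 1
  last : 2 ≤ 8 ^ k → ¬ ParallelToAxis (ca00gs.edge k (8 ^ k - 2)) 2

/-- The last edge inside an octant is not parallel to the axis of its exit facet, which is the axis
of the move that follows. -/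
theorem EdgesOK.exit {k : ℕ} (h : EdgesOK k) (hk : 2 ≤ 8 ^ k) (b : Fin 8) :
    ¬ ParallelToAxis (ca00gs.edge (k + 1) (b * 8 ^ k + (8 ^ k - 2)))
      ((ca00gs.symm b).perm (if ca00gs.reversed b then 1 else 2)) := by
  rw [ca00gs.edge_inside b (by omega)]
  cases ca00gs.reversed b
  · exact h.last hk
  · rw [if_pos rfl, if_pos rfl, Nat.sub_self]; exact h.first hk

theorem EdgesOK.enter {k : ℕ} (h : EdgesOK k) (hk : 2 ≤ 8 ^ k) (b : Fin 8) :
    ¬ ParallelToAxis (ca00gs.edge (k + 1) (b * 8 ^ k + 0))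
      ((ca00gs.symm b).perm (if ca00gs.reversed b then 2 else 1)) := by
  rw [ca00gs.edge_inside b (by omega)]
  cases ca00gs.reversed b
  · exact h.first hk
  · rw [if_pos rfl, if_pos rfl, Nat.sub_zero]; exact h.last hk

theorem edgesOK (k : ℕ) : EdgesOK k := by
  induction k with
  | zero =>
    refine ⟨fun i hi => ?_, fun i hi => ?_, fun h => ?_, fun h => ?_⟩ <;>
      (rw [pow_zero] at *; omega)
  | succ k ih =>
    have hpos : 0 < 8 ^ k := by positivity
    have hsucc : 8 ^ (k + 1) = 8 * 8 ^ k := pow_succ' _ _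
    have hnext : ∀ b : Fin 7, (b.castSucc : ℕ) * 8 ^ k + 8 ^ k = (b.succ : ℕ) * 8 ^ k := fun b => by
      rw [Fin.val_succ, Fin.val_castSucc, add_mul, one_mul]
    have hcast : ∀ b : Fin 8, (b : ℕ) * 8 ^ k + 8 ^ k < 8 ^ (k + 1) → ∃ c : Fin 7, b = c.castSucc :=
      fun b hb => by
        refine ⟨⟨b, ?_⟩, rfl⟩
        by_contra hb'
        have := Nat.mul_le_mul_right (8 ^ k) (not_lt.1 hb')
        omega
    refine ⟨fun i hi => ?_, fun i hi l hl hl' => ?_, fun _ hl => ?_, fun _ hl => ?_⟩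
    · obtain ⟨b, j, hj, rfl⟩ := exists_block ((Nat.lt_succ_self i).trans hi)
      rcases (Nat.succ_le_of_lt hj).lt_or_eq with h | h
      · obtain ⟨a, ha⟩ := ih.parallel (if ca00gs.reversed b then 8 ^ k - 2 - j else j)
          (by split_ifs <;> omega)
        exact ⟨_, (ca00gs.edge_inside b h a).2 ha⟩
      · obtain ⟨c, rfl⟩ := hcast b (by omega)
        obtain rfl : j = 8 ^ k - 1 := by omega
        exact ⟨_, ca00gs_edge_between k c⟩
    · obtain ⟨b, j, hj, rfl⟩ := exists_block (show i < 8 ^ (k + 1) by omega)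
      -- Either both edges lie inside the octant, or the second one leaves it, or the first one
      -- does.
      rcases lt_trichotomy (j + 2) (8 ^ k + 1) with h | h | h
      · rcases (show j + 2 ≤ 8 ^ k by omega).lt_or_eq with h' | h'
        · obtain ⟨a, rfl⟩ := (ca00gs.symm b).perm.surjective l
          rw [ca00gs.edge_inside b (by omega)] at hl
          rw [add_assoc, ca00gs.edge_inside b (by omega)] at hl'
          revert hl hl'
          cases ca00gs.reversed b
          · exact ih.turn j h' a
          · simp only [if_true]
            intro hl hl'
            refine ih.turn (8 ^ k - 2 - (j + 1)) (by omega) a hl' ?_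
            rwa [show 8 ^ k - 2 - (j + 1) + 1 = 8 ^ k - 2 - j by omega]
        · obtain ⟨c, rfl⟩ := hcast b (by omega)
          obtain rfl : j = 8 ^ k - 2 := by omega
          rw [add_assoc, show 8 ^ k - 2 + 1 = 8 ^ k - 1 by omega] at hl'
          have hexit := ih.exit (by omega) c.castSucc
          rw [ca00gs_perm_exit] at hexit
          exact hexit ((ca00gs_edge_between k c).unique hl' ▸ hl)
      · obtain ⟨c, rfl⟩ := hcast b (by omega)
        obtain rfl : j = 8 ^ k - 1 := by omega
        have hl₁ := (ca00gs_edge_between k c).unique hl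
        have e : (c.castSucc : ℕ) * 8 ^ k + (8 ^ k - 1) + 1 = (c.succ : ℕ) * 8 ^ k + 0 := by
          have := hnext c
          omega
        rw [e] at hl'
        rcases (show 1 ≤ 8 ^ k from hpos).lt_or_eq with h1 | h1
        · have henter := ih.enter h1 c.succ
          rw [ca00gs_perm_enter] at henter
          exact henter (hl₁ ▸ hl')
        -- For `k = 0` octants have no inner edges, so two consecutive moves of the base pattern
        -- meet; their axes differ.
        · obtain ⟨d, hd⟩ := hcast c.succ (by have := hnext c; omega)
          have hd' := ca00gs_edge_between k d
          rw [← hd, ← h1] at hd'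
          rw [← h1] at hl'
          have := hd'.unique hl'
          rw [← hl₁] at this
          revert hd this
          clear * -
          revert c d
          decide +kernel
      · omega
    · have e : ((0 : Fin 8) : ℕ) * 8 ^ k + 0 = 0 := by simp
      rcases (show 1 ≤ 8 ^ k from hpos).lt_or_eq with h1 | h1
      · have henter := ih.enter h1 0
        rw [e] at henter
        exact henter hl
      · have := ca00gs_edge_between k 0
        rw [← h1] at this
        exact absurd (this.unique hl) (by decide)
    · rcases (show 1 ≤ 8 ^ k from hpos).lt_or_eq with h1 | h1
      · have hexit := ih.exit h1 7
        rw [show ((7 : Fin 8) : ℕ) * 8 ^ k + (8 ^ k - 2) = 8 ^ (k + 1) - 2 by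
          rw [show ((7 : Fin 8) : ℕ) = 7 from rfl]; omega] at hexit
        exact hexit hl
      · have := ca00gs_edge_between k 6
        rw [← h1] at this
        rw [hsucc, ← h1] at hl
        exact absurd (this.unique hl) (by decide)

theorem ca00gs_isHyperorthogonal : ca00gs.IsHyperorthogonal := by
  intro k n i _ hn hi
  have ok := edgesOK k
  interval_cases n
  · obtain ⟨j, hj⟩ := ok.parallel i hi
    refine ⟨{j}, rfl, fun m hm => ⟨j, by simp, ?_⟩, fun l hl => ⟨0, by norm_num, ?_⟩⟩
    · obtain rfl : m = 0 := by omega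
      exact hj
    · rw [Finset.mem_singleton.1 hl]
      exact hj
  · obtain ⟨j, hj⟩ := ok.parallel i (by omega)
    obtain ⟨l, hl⟩ := ok.parallel (i + 1) (by omega)
    have hne : j ≠ l := fun h => ok.turn i hi j hj (h ▸ hl)
    refine ⟨{j, l}, Finset.card_pair hne, fun m hm => ?_, fun a ha => ?_⟩
    · obtain rfl | rfl : m = 0 ∨ m = 1 := by omega
      · exact ⟨j, by simp, hj⟩
      · exact ⟨l, by simp, hl⟩
    · rcases Finset.mem_insert.1 ha with rfl | ha
      · exact ⟨0, by norm_num, hj⟩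
      · rw [Finset.mem_singleton.1 ha]
        exact ⟨1, by norm_num, hl⟩

/-! ### Distances from the edges of a facet -/

/-- The distance of a point from a face that differs from a face containing it on one axis. -/
theorem infDist_face {p : E3} (hp : p ∈ cube) {e : Fin 3 → SignType} {l : Fin 3} (hl : e l ≠ 0)
    (h : ∀ m, m ≠ l → e m ≠ 0 → p m = (e m : ℝ) / 2) :
    Metric.infDist p (face e) = |p l - (e l : ℝ) / 2| := by
  -- The nearest point of the face changes coordinate `l` only.
  have hq : WithLp.toLp 2 (Function.update p.ofLp l ((e l : ℝ) / 2)) ∈ face e := by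
    refine ⟨fun j => ?_, fun j hj => ?_⟩
    · by_cases hjl : j = l
      · subst hjl
        simp only [Function.update_self]
        rw [abs_div, abs_cast_sign hl]; norm_num
      · simp only [Function.update_of_ne hjl]
        exact hp j
    · by_cases hjl : j = l
      · subst hjl
        simp only [Function.update_self]
      · simp only [Function.update_of_ne hjl]
        exact h j hjl hj
  apply le_antisymm
  · refine (Metric.infDist_le_dist_of_mem hq).trans_eq ?_
    rw [EuclideanSpace.dist_eq, Finset.sum_eq_single l]
    · simp [Real.dist_eq, Real.sqrt_sq_eq_abs]
    · intro j _ hj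
      simp [Function.update_of_ne hj]
    · simp
  · rw [Metric.le_infDist ⟨_, hq⟩]
    intro y hy
    rw [← hy.2 l hl, dist_eq_norm, ← Real.norm_eq_abs]
    exact PiLp.norm_apply_le (p - y) l

theorem half_mem_face (e : Fin 3 → SignType) :
    WithLp.toLp 2 (fun j => (e j : ℝ) / 2) ∈ face e := by
  refine ⟨fun j => ?_, fun j _ => rfl⟩
  show |(e j : ℝ) / 2| ≤ 1 / 2
  by_cases h : e j = 0
  · simp [h]
  · rw [abs_div, abs_cast_sign h]; norm_num

theorem cast_sign_injective : Function.Injective fun s : SignType => (s : ℝ) := by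
  intro s t h
  cases s <;> cases t <;> first | rfl | (simp at h; try linarith)

theorem eq_of_face_subset {e f : Fin 3 → SignType} (h : face e ⊆ face f) {j : Fin 3}
    (hj : f j ≠ 0) : e j = f j := by
  have := (h (half_mem_face e)).2 j hj
  refine cast_sign_injective ?_
  simp only at this ⊢
  linarith

/-- The edge of the facet `x_j = s j / 2` on which the coordinate `l` is fixed at `s l / 2`. -/
def edgeOn (s : Fin 3 → SignType) (j l : Fin 3) (m : Fin 3) : SignType :=
  if m = j ∨ m = l then s m else 0

theorem faceDim_edgeOn : ∀ (s : Fin 3 → SignType) (j l : Fin 3), s j ≠ 0 → s l ≠ 0 → j ≠ l →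
    faceDim (edgeOn s j l) = 1 := by
  decide +kernel

theorem exists_axes_of_faceDim : ∀ f : Fin 3 → SignType, faceDim f = 2 →
    ∃ j k l : Fin 3, f j ≠ 0 ∧ j ≠ k ∧ j ≠ l ∧ k ≠ l ∧ f k = 0 ∧ f l = 0 := by
  decide +kernel

/-- These are the four edges of a facet: two through the vertex `s`, and the two opposite to them.
-/
theorem edge_cases : ∀ (s e : Fin 3 → SignType) (j k l : Fin 3), (∀ m, s m ≠ 0) →
    j ≠ k → j ≠ l → k ≠ l → faceDim e = 1 → e j = s j →
    e = edgeOn s j k ∨ e = edgeOn s j l ∨ (e k = -s k ∧ e l = 0) ∨ (e l = -s l ∧ e k = 0) := by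
  decide +kernel

theorem exists_sign_sixth {x : ℝ} (hx : |x| = 1 / 6) : ∃ s : SignType, s ≠ 0 ∧ x = (s : ℝ) / 6 := by
  rcases (abs_eq (by norm_num)).1 hx with h | h
  · exact ⟨1, by decide, by simp [h]⟩
  · exact ⟨-1, by decide, by simp [h]; norm_num⟩

theorem cast_sign_cases {s : SignType} (hs : s ≠ 0) : (s : ℝ) = 1 ∨ (s : ℝ) = -1 := by
  cases s <;> simp_all

theorem thirdFromTwoAdjacentEdges {p : E3} {a : Fin 3} (ha : IsGateOn p a)
    (hp : ∀ l, l ≠ a → |p l| = 1 / 6) {f : Fin 3 → SignType} (hf : faceDim f = 2)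
    (hpf : p ∈ face f) : ThirdFromTwoAdjacentEdges p f := by
  obtain ⟨j, k, l, hj, hjk, hjl, hkl, hfk, hfl⟩ := exists_axes_of_faceDim f hf
  obtain rfl : j = a := ha.eq_of_abs (abs_eq_half_of_mem_face hpf hj)
  have hcover : ∀ m, m = j ∨ m = k ∨ m = l := by
    revert hjk hjl hkl
    clear * -
    revert j k l
    decide
  obtain ⟨u, hu, hpu⟩ := exists_sign_sixth (hp k hjk.symm)
  obtain ⟨v, hv, hpv⟩ := exists_sign_sixth (hp l hjl.symm)
  -- The vertex of the facet nearest to `p`, where the two near edges meet. The near edges are at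
  -- distance 1/2 - 1/6 = 1/3, the far ones at 1/2 + 1/6 = 2/3.
  let s : Fin 3 → SignType := fun m => if m = j then f j else if m = k then u else v
  have hsj : s j = f j := if_pos rfl
  have hsk : s k = u := by simp only [s, if_neg hjk.symm, if_pos]
  have hsl : s l = v := by simp only [s, if_neg hjl.symm, if_neg hkl.symm]
  have hs : ∀ m, s m ≠ 0 := fun m => by
    rcases hcover m with rfl | rfl | rfl
    · rwa [hsj]
    · rwa [hsk]
    · rwa [hsl]
  have hpj := hpf.2 j hj
  have hsub : ∀ e : Fin 3 → SignType, e j = f j → face e ⊆ face f := fun e he x hx => by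
    refine ⟨hx.1, fun m hm => ?_⟩
    obtain rfl : m = j := by
      rcases hcover m with rfl | rfl | rfl
      · rfl
      · exact absurd hfk hm
      · exact absurd hfl hm
    rw [hx.2 m (he ▸ hm), he]
  have ekj : edgeOn s j k j = f j := by simp [edgeOn, hsj]
  have elj : edgeOn s j l j = f j := by simp [edgeOn, hsj]
  have ekk : edgeOn s j k k = u := by simp [edgeOn, hsk]
  have ekl : edgeOn s j k l = 0 := by simp [edgeOn, hjl.symm, hkl.symm]
  have ell : edgeOn s j l l = v := by simp [edgeOn, hsl]
  have elk : edgeOn s j l k = 0 := by simp [edgeOn, hjk.symm, hkl]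
  have distk : ∀ e : Fin 3 → SignType, e j = f j → e k ≠ 0 → e l = 0 →
      Metric.infDist p (face e) = |(u : ℝ) / 6 - (e k : ℝ) / 2| := fun e h1 h2 h3 => by
    rw [← hpu]
    refine infDist_face hpf.1 h2 fun m hm hm' => ?_
    rcases hcover m with rfl | rfl | rfl
    · rw [hpj, h1]
    · exact absurd rfl hm
    · exact absurd h3 hm'
  have distl : ∀ e : Fin 3 → SignType, e j = f j → e l ≠ 0 → e k = 0 →
      Metric.infDist p (face e) = |(v : ℝ) / 6 - (e l : ℝ) / 2| := fun e h1 h2 h3 => by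
    rw [← hpv]
    refine infDist_face hpf.1 h2 fun m hm hm' => ?_
    rcases hcover m with rfl | rfl | rfl
    · rw [hpj, h1]
    · exact absurd h3 hm'
    · exact absurd rfl hm
  have near : ∀ {w : SignType}, w ≠ 0 → |(w : ℝ) / 6 - (w : ℝ) / 2| = 1 / 3 := fun hw => by
    rcases cast_sign_cases hw with h | h <;> rw [h] <;> norm_num [abs_of_pos, abs_of_neg]
  have far : ∀ {w : SignType}, w ≠ 0 → 1 / 3 < |(w : ℝ) / 6 - ((-w : SignType) : ℝ) / 2| :=
    fun {w} hw => by
      have hneg : ((-w : SignType) : ℝ) = -(w : ℝ) := by cases w <;> simp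
      rw [hneg]
      rcases cast_sign_cases hw with h | h <;> rw [h] <;> norm_num [abs_of_pos, abs_of_neg]
  have hne : edgeOn s j k ≠ edgeOn s j l := fun h => hu (by rw [← ekk, h, elk])
  refine ⟨edgeOn s j k, edgeOn s j l, hne,
    ⟨faceDim_edgeOn s j k (hs j) (hs k) hjk, hsub _ ekj⟩,
    ⟨faceDim_edgeOn s j l (hs j) (hs l) hjl, hsub _ elj⟩,
    ⟨WithLp.toLp 2 (fun m => (s m : ℝ) / 2), ?_, ?_⟩, ?_, ?_, fun e he h1 h2 => ?_⟩
  · refine ⟨(half_mem_face s).1, fun m hm => ?_⟩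
    have : edgeOn s j k m = s m := by
      unfold edgeOn at hm ⊢
      split_ifs at hm ⊢ <;> simp_all
    rw [this]
  · refine ⟨(half_mem_face s).1, fun m hm => ?_⟩
    have : edgeOn s j l m = s m := by
      unfold edgeOn at hm ⊢
      split_ifs at hm ⊢ <;> simp_all
    rw [this]
  · rw [distk _ ekj (by rwa [ekk]) ekl, ekk, near hu]
  · rw [distl _ elj (by rwa [ell]) elk, ell, near hv]
  · have hej := eq_of_face_subset he.2 hj
    rcases edge_cases s e j k l hs hjk hjl hkl he.1 (hej.trans hsj.symm) with h | h | h | h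
    · exact absurd h h1
    · exact absurd h h2
    · rw [distk e hej (by rw [h.1, hsk]; simpa using hu) h.2, h.1, hsk]
      exact far hu
    · rw [distl e hej (by rw [h.1, hsl]; simpa using hv) h.2, h.1, hsl]
      exact far hv

theorem abs_ca00gsGate (b : Bool) (l : Fin 3) (hl : l ≠ pair 1 2 b) :
    |ca00gsGate b l| = 1 / 6 := by
  cases b <;> fin_cases l <;> simp [ca00gsGate, pair, abs_div] at hl ⊢

theorem thirdFromTwoAdjacentEdges_map (γ : CubeSymm) (b : Bool) {f : Fin 3 → SignType}
    (hf : faceDim f = 2) (hpf : γ.map (ca00gsGate b) ∈ face f) :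
    ThirdFromTwoAdjacentEdges (γ.map (ca00gsGate b)) f := by
  refine thirdFromTwoAdjacentEdges ((isGateOn_ca00gsGate b).map γ) (fun l hl => ?_) hf hpf
  rw [γ.abs_map_apply]
  exact abs_ca00gsGate b _ fun h => hl (by rw [← h, Equiv.apply_symm_apply])

theorem exists_gate_of_equivalent {τ β : unitInterval → E3} (h : Equivalent τ β) {p : E3}
    (hp : p = τ 0 ∨ p = τ 1) : ∃ γ : CubeSymm, ∃ b, p = γ.map (gate β b) := by
  obtain ⟨γ, h | h⟩ := h
  · rcases hp with rfl | rfl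
    · exact ⟨γ, false, h 0⟩
    · exact ⟨γ, true, h 1⟩
  · rcases hp with rfl | rfl
    · exact ⟨γ, true, by rw [h, unitInterval.symm_zero]; rfl⟩
    · exact ⟨γ, false, by rw [h, unitInterval.symm_one]; rfl⟩

end Hilbert3D

/-! ### The theorem and its corollary -/

theorem mainTheorem5 :
    (∃ β : unitInterval → Hilbert3D.E3,
      Hilbert3D.ca00gs.Traces β ∧
      Hilbert3D.ca00gs.IsWellFolded ∧
      Hilbert3D.ca00gs.IsHyperorthogonal ∧
      Hilbert3D.IsHilbertCurve β ∧
      Hilbert3D.IsFacetGated β ∧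
      ∀ τ : unitInterval → Hilbert3D.E3,
        Hilbert3D.IsHilbertCurve τ → Hilbert3D.IsFacetGated τ → Hilbert3D.Equivalent τ β) ∧
    ∀ τ : unitInterval → Hilbert3D.E3,
      Hilbert3D.IsHilbertCurve τ → Hilbert3D.IsFacetGated τ →
      ∀ p : Hilbert3D.E3, p = τ 0 ∨ p = τ 1 →
      ∀ f : Fin 3 → SignType, Hilbert3D.faceDim f = 2 → p ∈ Hilbert3D.face f →
        Hilbert3D.ThirdFromTwoAdjacentEdges p f := by
  obtain ⟨β, hβ, hgate⟩ := Hilbert3D.ca00gs.exists_traces Hilbert3D.ca00gs_compatible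
  have hequiv : ∀ τ : unitInterval → Hilbert3D.E3,
      Hilbert3D.IsHilbertCurve τ → Hilbert3D.IsFacetGated τ → Hilbert3D.Equivalent τ β :=
    fun τ => Hilbert3D.equivalent_of_isFacetGated hβ
  have hgated : ∀ b, Hilbert3D.IsFacetGate (Hilbert3D.gate β b) := fun b => by
    rw [hgate, Hilbert3D.isFacetGate_iff]
    exact ⟨_, Hilbert3D.isGateOn_ca00gsGate b⟩
  refine ⟨⟨β, hβ, Hilbert3D.ca00gs_isWellFolded, Hilbert3D.ca00gs_isHyperorthogonal,
    ⟨_, hβ⟩, ⟨hgated false, hgated true⟩, hequiv⟩, fun τ hτ hg p hp f hf hpf => ?_⟩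
  obtain ⟨γ, b, rfl⟩ := Hilbert3D.exists_gate_of_equivalent (hequiv τ hτ hg) hp
  rw [hgate] at hpf ⊢
  exact Hilbert3D.thirdFromTwoAdjacentEdges_map γ b hf hpf
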